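/- Let $\widehat{\mathrm{Diff}}(\mathbb{C}^n,0)$ be the set of $n$-tuples $f=(f_1,\dots,f_n)$ of formal power series $f_k=\sum_{|j|\ge 1}a_{j;k}\,y^j\in\mathbb{C}[[y_1,\dots,y_n]]$ whose linear part $df(0)$ is an invertible matrix. Every such $f$ has a unique Jordan–Chevalley decomposition $f=f_s\circ f_u=f_u\circ f_s$ in $\widehat{\mathrm{Diff}}(\mathbb{C}^n,0)$, where $f_s$ is formally conjugated to a diagonal linear map and $df_u(0)$ has $1$ as its only eigenvalue. For a complex matrix $A$, write $A=A_s+A_N$ for its additive Jordan decomposition ($A_s$ diagonalizable, $A_N$ nilpotent, $A_sA_N=A_NA_s$). Let $f\in\widehat{\mathrm{Diff}}(\mathbb{C}^n,0)$ and let $A$ be an $n\times n$ complex matrix such that $df(0)=e^{2\pi iA}$, $A_s=\mathrm{diag}(\mu_1,\dots,\mu_n)$ and $f_s(y_1,\dots,y_n)=(\lambda_1y_1,\dots,\lambda_ny_n)$ with $\lambda_k=e^{2\pi i\mu_k}$ (that is, $f$ is in formal normal form with respect to $A$). Suppose that all eigenvalues of $A$ have negative real part, and that $f$ has no negative resonances: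 there are no $j\in\mathbb{Z}_{\ge0}^n$ with $|j|=j_1+\dots+j_n\ge2$ and $1\le k\le n$ such that $a_{j;k}\ne0$ and $\mu_k-j_1\mu_1-\dots-j_n\mu_n$ is a negative integer. Then for every $\nu\in\mathbb{N}$ there is a polynomial map $G:\mathbb{C}\times\mathbb{C}^n\to\mathbb{C}^n$ with $G(x,0)=0$ for all $x$ and $dG(0)=0$ such that the holonomy $h$ of the system $$x'=x,\qquad y'=A\,y+G(x,y)$$ computed on the transversal $\{x=1\}$ (the germ at $0$ of the biholomorphism of $(\mathbb{C}^n,0)$ that sends $y$ to the end point of the lift, starting at $(1,y)$, of the loop $x=e^{i\theta}$, $0\le\theta\le2\pi$, to the leaf through $(1,y)$) satisfies $j^\nu h=j^\nu f$, i.e. $h$ and $f$ have the same Taylor coefficients up to order $\nu$ at the origin. -/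

import Mathlib

open Filter Topology

noncomputable section

namespace FormalHolonomy

/-! ### Linear algebra -/

/-- `M = S + N` is the additive Jordan decomposition of `M`: `S` is diagonalizable, `N` is
nilpotent and they commute (`S` and `N` are uniquely determined by `M`). -/
structure IsAdditiveJordan {n : ℕ} (M S N : Matrix (Fin n) (Fin n) ℂ) : Prop where
  add_eq : M = S + N
  commute : S * N = N * S
  diagonalizable : ∃ P : Matrix (Fin n) (Fin n) ℂ, IsUnit P ∧
    ∃ d : Fin n → ℂ, S * P = P * Matrix.diagonal d
  nilpotent : IsNilpotent N

/-- All eigenvalues have negative real part. -/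
def HasNegativeSpectrum {n : ℕ} (A : Matrix (Fin n) (Fin n) ℂ) : Prop :=
  ∀ z ∈ spectrum ℂ A, z.re < 0

/-! ### Formal diffeomorphisms of `(ℂⁿ, 0)` -/

/-- `n`-tuples of formal power series in `n` variables. -/
abbrev FormalMap (n : ℕ) : Type := Fin n → MvPowerSeries (Fin n) ℂ

/-- The coefficient `a_{j;k}` of the monomial `y^j e_k`. -/
def FormalMap.coef {n : ℕ} (f : FormalMap n) (j : Fin n →₀ ℕ) (k : Fin n) : ℂ :=
  MvPowerSeries.coeff j (f k)

/-- The matrix of the linear part `df(0)`. -/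
def FormalMap.linearPart {n : ℕ} (f : FormalMap n) : Matrix (Fin n) (Fin n) ℂ :=
  Matrix.of fun k l => f.coef (Finsupp.single l 1) k

/-- A formal diffeomorphism fixing the origin: no constant term, invertible linear part. -/
structure IsFormalDiffeo {n : ℕ} (f : FormalMap n) : Prop where
  constantCoeff_eq_zero : ∀ k, MvPowerSeries.constantCoeff (f k) = 0
  isUnit_linearPart : IsUnit f.linearPart

/-- Composition `f ∘ g` (meaningful when `g` has no constant term). -/
def FormalMap.comp {n : ℕ} (f g : FormalMap n) : FormalMap n :=
  fun k => MvPowerSeries.subst g (f k)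

/-- The diagonal linear map `(y₁, …, yₙ) ↦ (lam₁ y₁, …, lamₙ yₙ)`. -/
def diagonalMap {n : ℕ} (lam : Fin n → ℂ) : FormalMap n :=
  fun k => MvPowerSeries.C (lam k) * MvPowerSeries.X k

/-- `f = s ∘ u = u ∘ s` is the Jordan-Chevalley decomposition of the formal diffeomorphism `f`
(`s` and `u` are uniquely determined by `f`). Unipotence is written as `⊆ {1}` and not as `= {1}`
only because the spectrum is empty for `n = 0`. -/
structure IsJordanChevalley {n : ℕ} (f s u : FormalMap n) : Prop where
  diffeo_s : IsFormalDiffeo s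
  diffeo_u : IsFormalDiffeo u
  eq_comp : f = s.comp u
  eq_comp' : f = u.comp s
  semisimple : ∃ psi : FormalMap n, IsFormalDiffeo psi ∧
    ∃ d : Fin n → ℂ, psi.comp s = (diagonalMap d).comp psi
  unipotent : spectrum ℂ u.linearPart ⊆ {1}

/-- `f` is in formal normal form with respect to `A`, where `df(0) = exp(2πiA)`,
`A_s = diag(mu₁, …, muₙ)` and `f_s = diag(exp(2πi mu₁), …, exp(2πi muₙ))`. -/
structure IsInNormalForm {n : ℕ} (f : FormalMap n) (A : Matrix (Fin n) (Fin n) ℂ)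
    (mu : Fin n → ℂ) : Prop where
  linearPart_eq : f.linearPart = NormedSpace.exp ((2 * Real.pi * Complex.I : ℂ) • A)
  jordan : ∃ N, IsAdditiveJordan A (Matrix.diagonal mu) N
  jordanChevalley : ∃ u, IsJordanChevalley f
    (diagonalMap fun k => Complex.exp (2 * Real.pi * Complex.I * mu k)) u

/-! ### Resonances -/

/-- `R_{j;k} = mu_k - ∑ j_l mu_l`. -/
def resonanceNumber {n : ℕ} (mu : Fin n → ℂ) (j : Fin n →₀ ℕ) (k : Fin n) : ℂ :=
  mu k - ∑ l, (j l : ℂ) * mu l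

/-- `(j;k)` is a negative resonance: `|j| ≥ 2` and `R_{j;k}` is a negative integer. -/
def IsNegativeResonance {n : ℕ} (mu : Fin n → ℂ) (j : Fin n →₀ ℕ) (k : Fin n) : Prop :=
  2 ≤ j.degree ∧ ∃ m : ℤ, m < 0 ∧ resonanceNumber mu j k = m

/-- No monomial that occurs in `f` is a negative resonance. -/
def HasNoNegativeResonances {n : ℕ} (f : FormalMap n) (mu : Fin n → ℂ) : Prop :=
  ∀ j k, f.coef j k ≠ 0 → ¬ IsNegativeResonance mu j k

/-! ### Polynomial systems and their holonomy -/

/-- The polynomial map `(x, y) ↦ G(x, y)`; the variable of index `0` is `x`, and the variable of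
index `k + 1` is `y_k`. -/
def polyMap {n : ℕ} (G : Fin n → MvPolynomial (Fin (n + 1)) ℂ) :
    ℂ × (Fin n → ℂ) → (Fin n → ℂ) :=
  fun p k => MvPolynomial.eval (Fin.cons p.1 p.2 : Fin (n + 1) → ℂ) (G k)

/-- The vector field of the system `x' = x`, `y' = A y + G(x, y)`. -/
def systemField {n : ℕ} (A : Matrix (Fin n) (Fin n) ℂ)
    (G : ℂ × (Fin n → ℂ) → (Fin n → ℂ)) (p : ℂ × (Fin n → ℂ)) : ℂ × (Fin n → ℂ) :=
  (p.1, A.mulVec p.2 + G p)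

/-- `G(x, 0) = 0` for all `x`, and `dG(0) = 0`. -/
structure IsAdmissible {n : ℕ} (G : ℂ × (Fin n → ℂ) → (Fin n → ℂ)) : Prop where
  vanish : ∀ x, G (x, 0) = 0
  deriv_zero : HasFDerivAt G (0 : ℂ × (Fin n → ℂ) →L[ℂ] (Fin n → ℂ)) 0

/-- `delta : [0, 2π] → ℂ × ℂⁿ` is a curve in a leaf of the foliation defined by `Z` (its velocity
is at every time a complex multiple of `Z`) that lifts, along the projection to the `x`-axis, the
positively oriented loop `x₀ exp(iθ)`. -/
def IsLeafLift {n : ℕ} (Z : ℂ × (Fin n → ℂ) → ℂ × (Fin n → ℂ)) (x₀ : ℂ)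
    (delta : ℝ → ℂ × (Fin n → ℂ)) : Prop :=
  ∀ θ ∈ Set.Icc (0 : ℝ) (2 * Real.pi),
    (delta θ).1 = x₀ * Complex.exp (θ * Complex.I) ∧
    ∃ c : ℂ, HasDerivWithinAt delta (c • Z (delta θ)) (Set.Icc 0 (2 * Real.pi)) θ

/-- The germ of `h` at `0` is the holonomy, along the loop `x₀ exp(iθ)` of the leaf
`{y = 0, x ≠ 0}` and computed on the transversal `{x = x₀}`, of the foliation defined by the vector
field `Z` on `ℂ × ℂⁿ`: every `y` near `0` is carried to the end point of the lift, starting at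
`(x₀, y)`, of the loop to the leaf through `(x₀, y)`. -/
def IsHolonomy {n : ℕ} (Z : ℂ × (Fin n → ℂ) → ℂ × (Fin n → ℂ)) (x₀ : ℂ)
    (h : (Fin n → ℂ) → (Fin n → ℂ)) : Prop :=
  ∀ᶠ y in 𝓝 (0 : Fin n → ℂ), ∃ delta : ℝ → ℂ × (Fin n → ℂ),
    IsLeafLift Z x₀ delta ∧ delta 0 = (x₀, y) ∧ delta (2 * Real.pi) = (x₀, h y)

/-- The germ of `h` at `0` belongs to `Diff(ℂⁿ, 0)`. -/
structure IsLocalBiholomorphism {n : ℕ} (h : (Fin n → ℂ) → (Fin n → ℂ)) : Prop where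
  map_zero : h 0 = 0
  analyticAt : AnalyticAt ℂ h 0
  invertible : (fderiv ℂ h 0).IsInvertible

/-- The Taylor polynomial of degree `≤ ν` of `f`, as a map `ℂⁿ → ℂⁿ`. -/
def FormalMap.taylor {n : ℕ} (f : FormalMap n) (ν : ℕ) (y : Fin n → ℂ) : Fin n → ℂ :=
  fun k => ∑ d ∈ Finset.range (ν + 1),
    ∑ j ∈ Finset.finsuppAntidiag (Finset.univ : Finset (Fin n)) d,
      f.coef j k * ∏ l, y l ^ j l

/-- `j^ν h = j^ν f` at the origin: `h` agrees with the `ν`-jet of `f` up to terms of order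
`ν + 1`. -/
def SameJet {n : ℕ} (ν : ℕ) (h : (Fin n → ℂ) → (Fin n → ℂ)) (f : FormalMap n) : Prop :=
  (fun y => h y - f.taylor ν y) =O[𝓝 0] fun y => ‖y‖ ^ (ν + 1)

end FormalHolonomy

end

noncomputable section

namespace FormalHolonomy

variable {n : ℕ}

/-! ### Polynomial interpolation of the iterates of an algebra endomorphism -/

section Interpolation

open Polynomial

/-! Write `f = f_s ∘ u` with `f_s = diag(exp(2πi mu_k))`. Since `u` commutes with `f_s`, each
monomial `y^j e_k` of `u` has integral resonance number `mu_k - ∑ j_l mu_l`; the hypothesis on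
negative resonances makes it a natural number (`jet_mem_resonantSubmodule`).

Modulo high order, `u` is the time-one map of a polynomial vector field `g` with linear part `2πi N`
and the same kind of monomials. Substitution of `u` is a unipotent endomorphism `U` of
`ℂ[y]/I^(ν+1)`, with `I` the ideal of the variables, so `U^m y_k` is polynomial in `m`; its
coefficient of degree one is `g_k` (`exists_infinitesimal_generator`).

The actual flow of `g` comes from inverting `γ ↦ γ - ∫ g(γ)` near zero in the space of curves on
`[0,1]`: the derivative is `1` minus a nilpotent Volterra operator. Its analytic time-one map `h`
has the prescribed jet, because the formal flow is an approximate solution and the inverse is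
Lipschitz (`exists_time_one_map`).

Finally put `x = exp(iθ)` and `y_k = exp(iθ mu_k) z_k(θ/2π)`, where `z' = g(z)`. The exponentials
arising from a nonlinear monomial `y^j e_k` of `g` combine into `x^w`, with `w` the resonance
number. As `w` is a natural number, the system in `(x, y)` is polynomial, and after one turn the end
point is `f_s(h(y))`, whose jet is that of `f` (`isHolonomy_of_time_one_map`). -/

theorem polynomial_eq_zero_of_eval_natCast {Q : Type*} [CommRing Q] [Algebra ℂ Q] (p : Q[X])
    (h : ∀ m : ℕ, p.eval (m : Q) = 0) : p = 0 := by
  ext i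
  -- `Q` may have zero divisors, so roots cannot be counted in `Q[X]`. A linear functional applied
  -- to the coefficients gives a complex polynomial vanishing on `ℕ`.
  rw [coeff_zero, ← Module.forall_dual_apply_eq_zero_iff ℂ]
  intro l
  set q : ℂ[X] := ∑ i ∈ Finset.range (p.natDegree + 1), C (l (p.coeff i)) * X ^ i with hq
  have hcoeff : ∀ i, q.coeff i = l (p.coeff i) := by
    intro i
    rw [hq, finsetSum_coeff]
    simp only [coeff_C_mul, coeff_X_pow]
    by_cases hi : i < p.natDegree + 1
    · rw [Finset.sum_eq_single i] <;> simp_all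
      intro b _ hb h'
      exact absurd h'.symm hb
    · rw [coeff_eq_zero_of_natDegree_lt (p := p) (by omega), map_zero]
      apply Finset.sum_eq_zero
      intro b hb
      rw [if_neg, mul_zero]
      rintro rfl
      exact hi (Finset.mem_range.1 hb)
  have heval : ∀ m : ℕ, q.eval (m : ℂ) = 0 := by
    intro m
    have h1 : l (p.eval (m : Q)) = 0 := by rw [h, map_zero]
    rw [eval_eq_sum_range, map_sum] at h1
    rw [hq, eval_finsetSum, ← h1]
    refine Finset.sum_congr rfl fun i _ => ?_
    have : p.coeff i * (m : Q) ^ i = ((m : ℂ) ^ i) • p.coeff i := by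
      rw [Algebra.smul_def, mul_comm]; simp
    rw [this, map_smul]
    simp only [eval_mul, eval_C, eval_pow, eval_X, smul_eq_mul]
    ring
  have hq0 : q = 0 := by
    apply eq_zero_of_infinite_isRoot
    refine Set.Infinite.mono (s := Set.range ((↑) : ℕ → ℂ)) ?_
      (Set.infinite_range_of_injective Nat.cast_injective)
    rintro _ ⟨m, rfl⟩
    exact heval m
  rw [← hcoeff, hq0, coeff_zero]

/-- The binomial polynomial `t ↦ (t choose j)` over a `ℂ`-algebra. -/
def binomialPolynomial (Q : Type*) [CommRing Q] [Algebra ℂ Q] (j : ℕ) : Q[X] :=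
  (C ((j.factorial : ℂ)⁻¹) * descPochhammer ℂ j).map (algebraMap ℂ Q)

theorem eval_binomialPolynomial {Q : Type*} [CommRing Q] [Algebra ℂ Q] (j m : ℕ) :
    (binomialPolynomial Q j).eval (m : Q) = (m.choose j : Q) := by
  have h1 : (m : Q) = algebraMap ℂ Q m := by simp
  have h2 : (m.choose j : Q) = algebraMap ℂ Q (m.choose j) := by simp
  rw [binomialPolynomial, h1, h2, eval_map_apply]
  congr 1
  rw [eval_mul, eval_C, descPochhammer_eval_eq_descFactorial, Nat.descFactorial_eq_factorial_mul_choose]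
  push_cast
  rw [inv_mul_cancel_left₀]
  exact_mod_cast j.factorial_ne_zero

/-- Newton's formula `U^m = ∑ (m choose j) (U - 1)^j`, cut off at `r` by unipotence at `x`. The
coefficients are combinations of the `(U - 1)^j x`, hence lie in every stable subspace containing
`x`; this later carries the resonance condition over to the generator. -/
theorem exists_interpolation {Q : Type*} [CommRing Q] [Algebra ℂ Q] (U : Q →ₐ[ℂ] Q) (x : Q)
    (r : ℕ) (hr : ((U.toLinearMap - 1 : Module.End ℂ Q) ^ r) x = 0) (V : Submodule ℂ Q)
    (hV : ∀ a ∈ V, U a ∈ V) (hx : x ∈ V) :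
    ∃ φ : Q[X], (∀ m : ℕ, φ.eval (m : Q) = (U ^ m) x) ∧ ∀ i, φ.coeff i ∈ V := by
  set W : Module.End ℂ Q := U.toLinearMap - 1 with hW
  have hWV : ∀ j, (W ^ j) x ∈ V := by
    intro j
    induction j with
    | zero => simpa
    | succ j ih =>
      rw [pow_succ', Module.End.mul_apply]
      exact V.sub_mem (hV _ ih) ih
  have hW0 : ∀ j, r ≤ j → (W ^ j) x = 0 := by
    intro j hj
    obtain ⟨c, rfl⟩ := Nat.exists_eq_add_of_le' hj
    rw [pow_add, Module.End.mul_apply, hr, map_zero]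
  refine ⟨∑ j ∈ Finset.range r, C ((W ^ j) x) * binomialPolynomial Q j, fun m => ?_, fun i => ?_⟩
  · have hUm : (U ^ m) x = ((W + 1) ^ m) x := by
      have : W + 1 = U.toLinearMap := by simp [hW]
      rw [this]
      clear hr hW0 hx hWV
      induction m with
      | zero => simp
      | succ m ih => rw [pow_succ', pow_succ', AlgHom.mul_apply, ih]; rfl
    rw [hUm, (Commute.one_right W).add_pow, LinearMap.sum_apply, eval_finsetSum]
    simp only [eval_mul, eval_C, eval_binomialPolynomial, one_pow, mul_one]
    have h3 : ∀ j, (W ^ j * (m.choose j : Module.End ℂ Q)) x = (W ^ j) x * (m.choose j : Q) := by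
      intro j
      rw [Module.End.mul_apply, Module.End.natCast_apply, map_nsmul, nsmul_eq_mul, mul_comm]
    simp only [h3]
    rw [← Finset.sum_subset (s₁ := Finset.range (min r (m + 1)))
        (Finset.range_subset_range.2 (min_le_left _ _)),
      ← Finset.sum_subset (s₁ := Finset.range (min r (m + 1)))
        (Finset.range_subset_range.2 (min_le_right _ _))]
    · intro j hj hj'
      rw [hW0 j, zero_mul]
      simp at hj hj'; omega
    · intro j hj hj'
      rw [Nat.choose_eq_zero_of_lt, Nat.cast_zero, mul_zero]
      simp at hj hj'; omega
  · rw [finsetSum_coeff]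
    refine V.sum_mem fun j _ => ?_
    rw [coeff_C_mul, binomialPolynomial, coeff_map, mul_comm, ← Algebra.smul_def]
    exact V.smul_mem _ (hWV j)

/-- The group law `φ(m + s) = U^m φ(s)` holds for natural `s`, hence as an identity of polynomials
in `s`; compare the coefficients of degree one. -/
theorem eval_derivative_interpolation {Q : Type*} [CommRing Q] [Algebra ℂ Q] (U : Q →ₐ[ℂ] Q)
    (x : Q) (φ : Q[X]) (hφ : ∀ m : ℕ, φ.eval (m : Q) = (U ^ m) x) (m : ℕ) :
    (derivative φ).eval (m : Q) = (U ^ m) (φ.coeff 1) := by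
  have h : taylor (m : Q) φ = φ.map (U ^ m : Q →ₐ[ℂ] Q).toRingHom := by
    rw [← sub_eq_zero]
    apply polynomial_eq_zero_of_eval_natCast
    intro s
    have h1 : (s : Q) = (U ^ m : Q →ₐ[ℂ] Q).toRingHom (s : Q) := by simp
    rw [eval_sub, taylor_eval, sub_eq_zero]
    conv_rhs => rw [h1, eval_map_apply, hφ]
    rw [← Nat.cast_add, hφ, add_comm, pow_add]
    rfl
  rw [← taylor_coeff_one, h, coeff_map]
  rfl

/-- An algebra endomorphism commutes with polynomial expressions: `U^m (g(x)) = g(U^m x)`. So the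
interpolated iterates solve `φ' = g(φ)` at all natural times, hence identically. -/
theorem derivative_eq_aeval_of_interpolation {Q ι : Type*} [CommRing Q] [Algebra ℂ Q]
    (U : Q →ₐ[ℂ] Q) (x : ι → Q) (φ : ι → Q[X])
    (hφ : ∀ k, ∀ m : ℕ, (φ k).eval (m : Q) = (U ^ m) (x k)) (g : MvPolynomial ι ℂ) (k : ι)
    (hg : MvPolynomial.aeval x g = (φ k).coeff 1) :
    derivative (φ k) = MvPolynomial.aeval φ g := by
  rw [← sub_eq_zero]
  apply polynomial_eq_zero_of_eval_natCast
  intro m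
  rw [eval_sub, sub_eq_zero, eval_derivative_interpolation U (x k) _ (hφ k), ← hg]
  have h1 : (MvPolynomial.aeval φ g).eval (m : Q)
      = MvPolynomial.aeval (fun l => (φ l).eval (m : Q)) g := by
    have h2 := MvPolynomial.comp_aeval_apply (R := ℂ) φ ((Polynomial.aeval (R := Q) (m : Q)).restrictScalars ℂ) g
    simpa [Polynomial.coe_aeval_eq_eval] using h2
  rw [h1]
  simp only [hφ]
  rw [← MvPolynomial.comp_aeval_apply]

end Interpolation

section PolynomialAlgebra

open MvPolynomial

/-! ### Exponentials of nilpotent matrices -/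

theorem exp_smul_eq_sum_of_pow_eq_zero {n r : ℕ} (N : Matrix (Fin n) (Fin n) ℂ) (hN : N ^ r = 0)
    (c : ℂ) : NormedSpace.exp (c • N)
      = ∑ i ∈ Finset.range r, ((i.factorial : ℂ)⁻¹ * c ^ i) • N ^ i := by
  rw [NormedSpace.exp_eq_tsum ℂ]
  dsimp only
  rw [tsum_eq_sum (s := Finset.range r)]
  · refine Finset.sum_congr rfl fun i _ => ?_
    rw [smul_pow, smul_smul]
  · intro i hi
    have : N ^ i = 0 := pow_eq_zero_of_le (by simpa using hi) hN
    rw [smul_pow, this, smul_zero, smul_zero]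

theorem isNilpotent_exp_sub_one {n : ℕ} (N : Matrix (Fin n) (Fin n) ℂ) (hN : IsNilpotent N) :
    IsNilpotent (NormedSpace.exp N - 1) := by
  obtain ⟨r, hr⟩ := hN
  have h := exp_smul_eq_sum_of_pow_eq_zero (r := r + 1) N (by rw [pow_succ, hr, zero_mul]) 1
  rw [one_smul, Finset.sum_range_succ'] at h
  simp only [Nat.factorial_zero, Nat.cast_one, inv_one, one_pow, mul_one, pow_zero, one_smul] at h
  rw [h, add_sub_cancel_right]
  have h2 : ∑ k ∈ Finset.range r, (((k + 1).factorial : ℂ)⁻¹) • N ^ (k + 1)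
      = N * ∑ k ∈ Finset.range r, (((k + 1).factorial : ℂ)⁻¹) • N ^ k := by
    rw [Finset.mul_sum]
    refine Finset.sum_congr rfl fun k _ => ?_
    rw [pow_succ', mul_smul_comm]
  rw [h2]
  refine Commute.isNilpotent_mul_right ?_ ⟨r, hr⟩
  refine Commute.sum_right _ _ _ fun k _ => ?_
  exact ((Commute.refl N).pow_right k).smul_right _

/-! ### Unipotent endomorphisms of a filtered algebra -/

section Filtered

variable {R : Type*} [CommRing R] [Algebra ℂ R] (U : R →ₐ[ℂ] R) (I : Ideal R)

theorem map_mem_pow (hU : ∀ a ∈ I, U a ∈ I) (d : ℕ) : ∀ a ∈ I ^ d, U a ∈ I ^ d := by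
  intro a ha
  have h1 : I.map U ≤ I := Ideal.map_le_iff_le_comap.2 hU
  have h2 := Ideal.mem_map_of_mem U ha
  rw [Ideal.map_pow] at h2
  exact Ideal.pow_right_mono h1 d h2

theorem sub_one_pow_mem_pow (hU : ∀ a ∈ I, U a ∈ I) (d r : ℕ) :
    ∀ a ∈ I ^ d, ((U.toLinearMap - 1 : Module.End ℂ R) ^ r) a ∈ I ^ d := by
  induction r with
  | zero => intro a ha; simpa
  | succ r ih =>
    intro a ha
    rw [pow_succ', Module.End.mul_apply]
    exact (I ^ d).sub_mem (map_mem_pow U I hU d _ (ih a ha)) (ih a ha)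

theorem sub_one_pow_mem_pow_of_le (hU : ∀ a ∈ I, U a ∈ I) (d : ℕ) {r s : ℕ} (hrs : r ≤ s) (a : R)
    (ha : ((U.toLinearMap - 1 : Module.End ℂ R) ^ r) a ∈ I ^ d) :
    ((U.toLinearMap - 1 : Module.End ℂ R) ^ s) a ∈ I ^ d := by
  obtain ⟨c, rfl⟩ := Nat.exists_eq_add_of_le' hrs
  rw [pow_add, Module.End.mul_apply]
  exact sub_one_pow_mem_pow U I hU d c _ ha

/-- With `W = U - 1`, one has `W(ab) = (Wa)b + a(Wb) + (Wa)(Wb)`, and each term lowers `p` or `q`: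
induction on `p + q`. -/
theorem exists_sub_one_pow_mul_mem (hU : ∀ a ∈ I, U a ∈ I) (i j N : ℕ) :
    ∀ (p q : ℕ), p + q ≤ N → ∀ a ∈ I ^ i, ∀ b ∈ I ^ j,
      ((U.toLinearMap - 1 : Module.End ℂ R) ^ p) a ∈ I ^ (i + 1) →
      ((U.toLinearMap - 1 : Module.End ℂ R) ^ q) b ∈ I ^ (j + 1) →
      ∃ r, ((U.toLinearMap - 1 : Module.End ℂ R) ^ r) (a * b) ∈ I ^ (i + j + 1) := by
  set W : Module.End ℂ R := U.toLinearMap - 1 with hW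
  have hWU : ∀ a, W a = U a - a := fun a => rfl
  induction N with
  | zero =>
    intro p q hpq a ha b hb hpa hqb
    obtain rfl : p = 0 := by omega
    refine ⟨0, ?_⟩
    have := Ideal.mul_mem_mul hpa hb
    rw [← pow_add] at this
    simpa [add_right_comm] using this
  | succ N ih =>
    intro p q hpq a ha b hb hpa hqb
    rcases p with _ | p
    · refine ⟨0, ?_⟩
      have := Ideal.mul_mem_mul hpa hb
      rw [← pow_add] at this
      simpa [add_right_comm] using this
    rcases q with _ | q
    · refine ⟨0, ?_⟩
      have := Ideal.mul_mem_mul ha hqb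
      rw [← pow_add] at this
      simpa [add_assoc] using this
    have hWa : W a ∈ I ^ i := (I ^ i).sub_mem (map_mem_pow U I hU i a ha) ha
    have hWb : W b ∈ I ^ j := (I ^ j).sub_mem (map_mem_pow U I hU j b hb) hb
    have hpa' : (W ^ p) (W a) ∈ I ^ (i + 1) := by rwa [pow_succ W, Module.End.mul_apply] at hpa
    have hqb' : (W ^ q) (W b) ∈ I ^ (j + 1) := by rwa [pow_succ W, Module.End.mul_apply] at hqb
    obtain ⟨r1, h1⟩ := ih p (q + 1) (by omega) _ hWa b hb hpa' hqb
    obtain ⟨r2, h2⟩ := ih (p + 1) q (by omega) a ha _ hWb hpa hqb'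
    obtain ⟨r3, h3⟩ := ih p q (by omega) _ hWa _ hWb hpa' hqb'
    refine ⟨(r1 + r2 + r3) + 1, ?_⟩
    have hmul : W (a * b) = W a * b + a * W b + W a * W b := by
      simp only [hWU, map_mul]; ring
    rw [pow_succ W, Module.End.mul_apply, hmul, map_add, map_add]
    refine Ideal.add_mem _ (Ideal.add_mem _ ?_ ?_) ?_
    · exact sub_one_pow_mem_pow_of_le U I hU _ (by omega) _ h1
    · exact sub_one_pow_mem_pow_of_le U I hU _ (by omega) _ h2
    · exact sub_one_pow_mem_pow_of_le U I hU _ (by omega) _ h3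

/-- Powers of `I` are spanned by products, so unipotence on `I/I^2` spreads to every graded piece.
-/
theorem exists_sub_one_pow_mem_pow_succ (hU : ∀ a ∈ I, U a ∈ I)
    (h1 : ∀ a ∈ I, ∃ r, ((U.toLinearMap - 1 : Module.End ℂ R) ^ r) a ∈ I ^ 2) (d : ℕ) :
    ∀ a ∈ I ^ (d + 1), ∃ r, ((U.toLinearMap - 1 : Module.End ℂ R) ^ r) a ∈ I ^ (d + 2) := by
  induction d with
  | zero => simpa using h1
  | succ d ih =>
    intro a ha
    rw [pow_succ I (d + 1)] at ha
    induction ha using Submodule.mul_induction_on' with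
    | mem_mul_mem x hx y hy =>
      obtain ⟨p, hp⟩ := ih x hx
      obtain ⟨q, hq⟩ := h1 y hy
      exact exists_sub_one_pow_mul_mem U I hU (d + 1) 1 (p + q) p q le_rfl x hx y (by simpa) hp hq
    | add x hx y hy ihx ihy =>
      obtain ⟨p, hp⟩ := ihx
      obtain ⟨q, hq⟩ := ihy
      refine ⟨p + q, ?_⟩
      rw [map_add]
      exact Ideal.add_mem _ (sub_one_pow_mem_pow_of_le U I hU _ (by omega) _ hp)
        (sub_one_pow_mem_pow_of_le U I hU _ (by omega) _ hq)

theorem exists_sub_one_pow_mem (hU : ∀ a ∈ I, U a ∈ I)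
    (h1 : ∀ a ∈ I, ∃ r, ((U.toLinearMap - 1 : Module.End ℂ R) ^ r) a ∈ I ^ 2) (d : ℕ) :
    ∀ a ∈ I, ∃ r, ((U.toLinearMap - 1 : Module.End ℂ R) ^ r) a ∈ I ^ (d + 1) := by
  induction d with
  | zero => intro a ha; exact ⟨0, by simpa⟩
  | succ d ih =>
    intro a ha
    obtain ⟨p, hp⟩ := ih a ha
    obtain ⟨q, hq⟩ := exists_sub_one_pow_mem_pow_succ U I hU h1 d _ hp
    exact ⟨q + p, by rwa [pow_add _ q p, Module.End.mul_apply]⟩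

end Filtered

/-! ### Linear parts of endomorphisms of the polynomial algebra -/

/-- `T` preserves `I^2` and acts on the variables modulo `I^2` through `B`. It is needed for `T = U`
and for `T = U - 1`. -/
theorem pow_apply_X_sub_mem (T : Module.End ℂ (MvPolynomial (Fin n) ℂ))
    (hT : ∀ a ∈ idealOfVars (Fin n) ℂ ^ 2, T a ∈ idealOfVars (Fin n) ℂ ^ 2)
    (B : Matrix (Fin n) (Fin n) ℂ)
    (hB : ∀ k, T (X k) - ∑ l, B k l • X l ∈ idealOfVars (Fin n) ℂ ^ 2) (m : ℕ) (k : Fin n) :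
    (T ^ m) (X k) - ∑ l, (B ^ m) k l • X l ∈ idealOfVars (Fin n) ℂ ^ 2 := by
  induction m with
  | zero => simp [Matrix.one_apply]
  | succ m ih =>
    have h1 := hT _ ih
    have h2 : ∑ l, (B ^ m) k l • (T (X l) - ∑ i, B l i • (X i : MvPolynomial (Fin n) ℂ))
        ∈ idealOfVars (Fin n) ℂ ^ 2 :=
      Submodule.sum_mem _ fun l _ => Submodule.smul_of_tower_mem _ _ (hB l)
    have h3 := Ideal.add_mem _ h1 h2
    convert h3 using 1
    rw [pow_succ', Module.End.mul_apply, map_sub, map_sum]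
    simp only [map_smul, smul_sub, Finset.sum_sub_distrib, Finset.smul_sum, smul_smul]
    rw [Finset.sum_comm]
    simp only [pow_succ, Matrix.mul_apply, Finset.sum_smul]
    abel

theorem exists_sub_one_pow_mem_sq (ub : Fin n → MvPolynomial (Fin n) ℂ)
    (hub : ∀ k, ub k ∈ idealOfVars (Fin n) ℂ) (M : Matrix (Fin n) (Fin n) ℂ)
    (hM : IsNilpotent (M - 1))
    (hlin : ∀ k, ub k - ∑ l, M k l • X l ∈ idealOfVars (Fin n) ℂ ^ 2) :
    (∀ a ∈ idealOfVars (Fin n) ℂ, aeval ub a ∈ idealOfVars (Fin n) ℂ) ∧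
    ∀ a ∈ idealOfVars (Fin n) ℂ, ∃ r,
      (((aeval ub).toLinearMap - 1 : Module.End ℂ (MvPolynomial (Fin n) ℂ)) ^ r) a
        ∈ idealOfVars (Fin n) ℂ ^ 2 := by
  set I := idealOfVars (Fin n) ℂ
  have hU : ∀ a ∈ I, aeval ub a ∈ I := by
    intro a ha
    have : I ≤ I.comap (aeval ub : MvPolynomial (Fin n) ℂ →ₐ[ℂ] _) := by
      rw [Ideal.span_le]
      rintro _ ⟨k, rfl⟩
      simpa using hub k
    exact this ha
  refine ⟨hU, fun a ha => ?_⟩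
  -- Constants are fixed, so `U - 1` sends everything into `I`. This handles the arbitrary
  -- polynomial coefficient in the `smul` case below.
  have hconst : ∀ c : MvPolynomial (Fin n) ℂ, ((aeval ub).toLinearMap - 1 :
      Module.End ℂ (MvPolynomial (Fin n) ℂ)) c ∈ I := by
    intro c
    have h1 : c - C (constantCoeff c) ∈ I := by
      have := (mem_pow_idealOfVars_iff' 1 (c - C (constantCoeff c))).2 (fun x hx => by
        obtain rfl : x = 0 := by
          rw [← Finsupp.degree_eq_zero_iff]; omega
        simp [constantCoeff_eq])
      simpa [I] using this
    have h2 := I.sub_mem (hU _ h1) h1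
    simpa using h2
  induction ha using Submodule.span_induction with
  | mem x hx =>
    obtain ⟨k, rfl⟩ := hx
    obtain ⟨r, hr⟩ := hM
    refine ⟨r, ?_⟩
    have := pow_apply_X_sub_mem ((aeval ub).toLinearMap - 1) (fun a ha => by
      simpa using sub_one_pow_mem_pow (aeval ub) I hU 2 1 a ha) (M - 1) (fun k => by
        have h := hlin k
        simpa [sub_smul, Matrix.one_apply, Finset.sum_sub_distrib] using h) r k
    simpa [hr] using this
  | zero => exact ⟨0, by simp⟩
  | add x y _ _ hx hy =>
    obtain ⟨p, hp⟩ := hx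
    obtain ⟨q, hq⟩ := hy
    refine ⟨p + q, ?_⟩
    rw [map_add]
    exact Ideal.add_mem _ (sub_one_pow_mem_pow_of_le _ I hU _ (by omega) _ hp)
      (sub_one_pow_mem_pow_of_le _ I hU _ (by omega) _ hq)
  | smul c x hx ih =>
    obtain ⟨p, hp⟩ := ih
    have := exists_sub_one_pow_mul_mem (aeval ub) I hU 0 1 (1 + p) 1 p le_rfl c (by simp) x
      (by simpa using hx) (by simpa using hconst c) hp
    simpa using this

/-! ### Monomials of non-negative integral resonance number -/

/-- The polynomials all of whose monomials `y^j` satisfy `c - ∑ j_l mu_l ∈ ℕ`. -/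
def resonantSubmodule (mu : Fin n → ℂ) (c : ℂ) : Submodule ℂ (MvPolynomial (Fin n) ℂ) :=
  restrictSupport ℂ {j | ∃ m : ℕ, c - ∑ l, (j l : ℂ) * mu l = m}

theorem mem_resonantSubmodule {mu : Fin n → ℂ} {c : ℂ} {p : MvPolynomial (Fin n) ℂ} :
    p ∈ resonantSubmodule mu c ↔
      ∀ j ∈ p.support, ∃ m : ℕ, c - ∑ l, (j l : ℂ) * mu l = m := by
  rw [resonantSubmodule, mem_restrictSupport_iff]
  rfl

theorem mul_mem_resonantSubmodule {mu : Fin n → ℂ} {c d : ℂ} {p q : MvPolynomial (Fin n) ℂ}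
    (hp : p ∈ resonantSubmodule mu c) (hq : q ∈ resonantSubmodule mu d) :
    p * q ∈ resonantSubmodule mu (c + d) := by
  rw [mem_resonantSubmodule] at hp hq ⊢
  intro j hj
  obtain ⟨a, ha, b, hb, hab⟩ := Finset.mem_add.1 (support_mul p q hj)
  have hj' : ∀ l, j l = a l + b l := fun l => by rw [← hab]; rfl
  obtain ⟨m1, h1⟩ := hp a ha
  obtain ⟨m2, h2⟩ := hq b hb
  refine ⟨m1 + m2, ?_⟩
  push_cast
  rw [← h1, ← h2]
  simp only [hj', Nat.cast_add, add_mul, Finset.sum_add_distrib]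
  ring

theorem one_mem_resonantSubmodule (mu : Fin n → ℂ) :
    (1 : MvPolynomial (Fin n) ℂ) ∈ resonantSubmodule mu 0 := by
  rw [mem_resonantSubmodule]
  intro j hj
  have : j = 0 := by
    by_contra h
    rw [mem_support_iff, coeff_one, if_neg (Ne.symm h)] at hj
    exact hj rfl
  exact ⟨0, by simp [this]⟩

theorem pow_mem_resonantSubmodule {mu : Fin n → ℂ} {c : ℂ} {p : MvPolynomial (Fin n) ℂ}
    (hp : p ∈ resonantSubmodule mu c) (m : ℕ) : p ^ m ∈ resonantSubmodule mu (m * c) := by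
  induction m with
  | zero => simpa using one_mem_resonantSubmodule mu
  | succ m ih =>
    rw [pow_succ]
    have := mul_mem_resonantSubmodule ih hp
    convert this using 2
    push_cast; ring

theorem prod_mem_resonantSubmodule {ι : Type*} {mu : Fin n → ℂ} (s : Finset ι) (c : ι → ℂ)
    (p : ι → MvPolynomial (Fin n) ℂ) (hp : ∀ i ∈ s, p i ∈ resonantSubmodule mu (c i)) :
    ∏ i ∈ s, p i ∈ resonantSubmodule mu (∑ i ∈ s, c i) := by
  classical
  induction s using Finset.induction_on with
  | empty => simpa using one_mem_resonantSubmodule mu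
  | insert a s ha ih =>
    rw [Finset.prod_insert ha, Finset.sum_insert ha]
    exact mul_mem_resonantSubmodule (hp a (by simp)) (ih fun i hi => hp i (by simp [hi]))

/-- Give `y_l` the weight `mu_l`; the submodule for `c` collects the weights in `c - ℕ`. Replacing
`y_l` by terms of weight in `mu_l - ℕ` lowers weights by natural numbers only. -/
theorem aeval_mem_resonantSubmodule {mu : Fin n → ℂ} (ub : Fin n → MvPolynomial (Fin n) ℂ)
    (hub : ∀ k, ub k ∈ resonantSubmodule mu (mu k)) (c : ℂ) (p : MvPolynomial (Fin n) ℂ)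
    (hp : p ∈ resonantSubmodule mu c) : aeval ub p ∈ resonantSubmodule mu c := by
  rw [aeval_def, eval₂_eq]
  refine Submodule.sum_mem _ fun j hj => ?_
  rw [← Algebra.smul_def]
  refine Submodule.smul_mem _ _ ?_
  obtain ⟨m, hm⟩ := mem_resonantSubmodule.1 hp j hj
  have h1 : ∏ i ∈ j.support, ub i ^ j i ∈
      resonantSubmodule mu (∑ i ∈ j.support, (j i : ℂ) * mu i) :=
    prod_mem_resonantSubmodule _ _ _ fun i _ => pow_mem_resonantSubmodule (hub i) _
  have h2 : ∑ i ∈ j.support, (j i : ℂ) * mu i = ∑ i, (j i : ℂ) * mu i := by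
    refine Finset.sum_subset (Finset.subset_univ _) fun i _ hi => ?_
    simp [Finsupp.notMem_support_iff.1 hi]
  rw [h2] at h1
  rw [mem_resonantSubmodule] at h1 ⊢
  intro i hi
  obtain ⟨m', hm'⟩ := h1 i hi
  refine ⟨m + m', ?_⟩
  push_cast
  rw [← hm, ← hm']
  ring

theorem X_mem_resonantSubmodule (mu : Fin n → ℂ) (k : Fin n) :
    (X k : MvPolynomial (Fin n) ℂ) ∈ resonantSubmodule mu (mu k) := by
  rw [mem_resonantSubmodule]
  intro j hj
  rw [support_X, Finset.mem_singleton] at hj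
  subst hj
  refine ⟨0, ?_⟩
  rw [Finset.sum_eq_single k] <;> simp +contextual

end PolynomialAlgebra

/-! ### The infinitesimal generator of a unipotent jet -/

theorem exists_eq_single_of_degree_eq_one {x : Fin n →₀ ℕ} (h : x.degree = 1) :
    ∃ l, x = Finsupp.single l 1 := by
  have hx : x ≠ 0 := by rintro rfl; simp at h
  obtain ⟨l, hl⟩ := Finsupp.ne_iff.1 hx
  have hle : Finsupp.single l 1 ≤ x := Finsupp.single_le_iff.2 (Nat.one_le_iff_ne_zero.2 hl)
  obtain ⟨y, rfl⟩ := exists_add_of_le hle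
  rw [map_add, Finsupp.degree_single] at h
  have hy : y = 0 := (Finsupp.degree_eq_zero_iff y).1 (by omega)
  exact ⟨l, by rw [hy, add_zero]⟩

theorem sub_linear_mem_sq {p : MvPolynomial (Fin n) ℂ} (c : Fin n → ℂ)
    (h0 : p ∈ MvPolynomial.idealOfVars (Fin n) ℂ)
    (h1 : ∀ l, p.coeff (Finsupp.single l 1) = c l) :
    p - ∑ l, c l • MvPolynomial.X l ∈ MvPolynomial.idealOfVars (Fin n) ℂ ^ 2 := by
  rw [MvPolynomial.mem_pow_idealOfVars_iff']
  intro x hx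
  have h2 : x.degree = 0 ∨ x.degree = 1 := by omega
  rw [MvPolynomial.coeff_sub, MvPolynomial.coeff_sum]
  simp only [MvPolynomial.coeff_smul, MvPolynomial.coeff_X]
  rcases h2 with h2 | h2
  · have := (MvPolynomial.mem_pow_idealOfVars_iff' 1 p).1 (by simpa using h0) x (by omega)
    rw [this]
    obtain rfl : x = 0 := (Finsupp.degree_eq_zero_iff x).1 h2
    simp
  · obtain ⟨l, rfl⟩ := exists_eq_single_of_degree_eq_one h2
    rw [h1, Finset.sum_eq_single l] <;> simp +contextual [Finsupp.single_left_inj]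

theorem coeff_single_eq_of_sub_mem_sq {p q : MvPolynomial (Fin n) ℂ}
    (h : p - q ∈ MvPolynomial.idealOfVars (Fin n) ℂ ^ 2) (l : Fin n) :
    p.coeff (Finsupp.single l 1) = q.coeff (Finsupp.single l 1) := by
  have := (MvPolynomial.mem_pow_idealOfVars_iff' 2 _).1 h (Finsupp.single l 1) (by simp)
  rwa [MvPolynomial.coeff_sub, sub_eq_zero] at this

theorem coeff_single_linear (c : Fin n → ℂ) (l : Fin n) :
    (∑ i, c i • (MvPolynomial.X i : MvPolynomial (Fin n) ℂ)).coeff (Finsupp.single l 1) = c l := by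
  rw [MvPolynomial.coeff_sum]
  simp only [MvPolynomial.coeff_smul, MvPolynomial.coeff_X]
  rw [Finset.sum_eq_single l] <;> simp +contextual [Finsupp.single_left_inj]

/-- `exp(N)^m = exp(mN)` is a polynomial in `m` whose coefficient of degree one is `N`. This
identifies the linear part of the generator. -/
theorem coeff_one_eq_of_eval_natCast_eq_exp {q : Polynomial ℂ}
    (N : Matrix (Fin n) (Fin n) ℂ) (hN : IsNilpotent N) (k l : Fin n)
    (h : ∀ m : ℕ, q.eval (m : ℂ) = (NormedSpace.exp N ^ m) k l) : q.coeff 1 = N k l := by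
  obtain ⟨r, hr⟩ := hN
  -- The exponent exceeds `1`, so that the truncated exponential contains the term of index one.
  have hr2 : N ^ (r + 2) = 0 := by rw [pow_add, hr, zero_mul]
  set e : Polynomial ℂ := ∑ i ∈ Finset.range (r + 2),
    Polynomial.C ((i.factorial : ℂ)⁻¹ * (N ^ i) k l) * Polynomial.X ^ i with he
  have hqe : q - e = 0 := by
    apply polynomial_eq_zero_of_eval_natCast
    intro m
    rw [Polynomial.eval_sub, h, sub_eq_zero, ← Matrix.exp_nsmul, ← Nat.cast_smul_eq_nsmul ℂ,
      exp_smul_eq_sum_of_pow_eq_zero N hr2, he, Polynomial.eval_finsetSum, Matrix.sum_apply]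
    refine Finset.sum_congr rfl fun i _ => ?_
    simp
    ring
  rw [sub_eq_zero.1 hqe, he, Polynomial.finsetSum_coeff]
  simp only [Polynomial.coeff_C_mul, Polynomial.coeff_X_pow]
  rw [Finset.sum_eq_single 1] <;> simp +contextual
  intro b _ hb h1
  exact absurd h1.symm hb

theorem exists_infinitesimal_generator (mu : Fin n → ℂ) (N : Matrix (Fin n) (Fin n) ℂ)
    (hN : IsNilpotent N) (ub : Fin n → MvPolynomial (Fin n) ℂ)
    (hub : ∀ k, ub k ∈ MvPolynomial.idealOfVars (Fin n) ℂ)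
    (hres : ∀ k, ub k ∈ resonantSubmodule mu (mu k))
    (hlin : ∀ k, ub k - ∑ l, NormedSpace.exp N k l • MvPolynomial.X l
      ∈ MvPolynomial.idealOfVars (Fin n) ℂ ^ 2) (ν : ℕ) (hν : 1 ≤ ν) :
    ∃ (g : Fin n → MvPolynomial (Fin n) ℂ) (Φ : Fin n → Polynomial (MvPolynomial (Fin n) ℂ)),
      (∀ k, g k ∈ resonantSubmodule mu (mu k)) ∧
      (∀ k, g k - ∑ l, N k l • MvPolynomial.X l ∈ MvPolynomial.idealOfVars (Fin n) ℂ ^ 2) ∧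
      (∀ k i, (Φ k).coeff i ∈ MvPolynomial.idealOfVars (Fin n) ℂ) ∧
      (∀ k i, (Polynomial.derivative (Φ k) - MvPolynomial.aeval Φ (g k)).coeff i
        ∈ MvPolynomial.idealOfVars (Fin n) ℂ ^ (ν + 1)) ∧
      (∀ k, (Φ k).eval 0 - MvPolynomial.X k ∈ MvPolynomial.idealOfVars (Fin n) ℂ ^ (ν + 1)) ∧
      (∀ k, (Φ k).eval 1 - ub k ∈ MvPolynomial.idealOfVars (Fin n) ℂ ^ (ν + 1)) := by
  classical
  set I := MvPolynomial.idealOfVars (Fin n) ℂ with hI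
  obtain ⟨hU, hW⟩ := exists_sub_one_pow_mem_sq ub hub _ (isNilpotent_exp_sub_one N hN) hlin
  set U₀ : MvPolynomial (Fin n) ℂ →ₐ[ℂ] MvPolynomial (Fin n) ℂ := MvPolynomial.aeval ub with hU₀
  have hJ1 : I ^ (ν + 1) ≤ I := Ideal.pow_le_self (by omega)
  have hJ2 : I ^ (ν + 1) ≤ I ^ 2 := Ideal.pow_le_pow_right (by omega)
  have hJ : I ^ (ν + 1) ≤ (I ^ (ν + 1)).comap U₀ := fun a ha => map_mem_pow U₀ I hU _ a ha
  set J := I ^ (ν + 1) with hJdef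
  let U : MvPolynomial (Fin n) ℂ ⧸ J →ₐ[ℂ] MvPolynomial (Fin n) ℂ ⧸ J := Ideal.quotientMapₐ J U₀ hJ
  let π : MvPolynomial (Fin n) ℂ →ₐ[ℂ] MvPolynomial (Fin n) ℂ ⧸ J := Ideal.Quotient.mkₐ ℂ J
  have hπ : Function.Surjective π := Ideal.Quotient.mkₐ_surjective ℂ J
  have hker : ∀ a b, π a = π b ↔ a - b ∈ J := fun a b => Ideal.Quotient.eq
  have hUπ : ∀ a, U (π a) = π (U₀ a) := fun a => rfl
  have hUm : ∀ (m : ℕ) a, (U ^ m) (π a) = π ((U₀ ^ m) a) := by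
    intro m
    induction m with
    | zero => intro a; simp
    | succ m ih => intro a; rw [pow_succ, pow_succ, AlgHom.mul_apply, AlgHom.mul_apply, hUπ, ih]
  have hWm : ∀ (m : ℕ) a, ((U.toLinearMap - 1 : Module.End ℂ (MvPolynomial (Fin n) ℂ ⧸ J)) ^ m) (π a)
      = π (((U₀.toLinearMap - 1 : Module.End ℂ (MvPolynomial (Fin n) ℂ)) ^ m) a) := by
    intro m
    induction m with
    | zero => intro a; simp
    | succ m ih =>
      intro a
      have h1 : (U.toLinearMap - 1 : Module.End ℂ (MvPolynomial (Fin n) ℂ ⧸ J)) (π a)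
        = π ((U₀.toLinearMap - 1 : Module.End ℂ (MvPolynomial (Fin n) ℂ)) a) := (map_sub π _ _).symm
      rw [pow_succ, pow_succ, Module.End.mul_apply, Module.End.mul_apply, h1, ih]
  have hXI : ∀ k, (MvPolynomial.X k : MvPolynomial (Fin n) ℂ) ∈ I := fun k => Ideal.subset_span ⟨k, rfl⟩
  -- Interpolation takes place in the quotient by `J`. The stable subspace is an image, so the
  -- coefficients have lifts that are resonant and without constant term; `g` is such a lift,
  -- whereas `Φ` is an arbitrary lift of `φ`.
  have hφ : ∀ k, ∃ φ : Polynomial (MvPolynomial (Fin n) ℂ ⧸ J),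
      (∀ m : ℕ, φ.eval (m : MvPolynomial (Fin n) ℂ ⧸ J) = (U ^ m) (π (MvPolynomial.X k))) ∧
      ∀ i, φ.coeff i ∈ (resonantSubmodule mu (mu k) ⊓ I.restrictScalars ℂ).map π.toLinearMap := by
    intro k
    obtain ⟨r, hr⟩ := exists_sub_one_pow_mem U₀ I hU hW ν _ (hXI k)
    refine exists_interpolation U (π (MvPolynomial.X k)) r ?_ _ ?_ ?_
    · rw [hWm, ← map_zero π, hker, sub_zero]
      exact hr
    · rintro _ ⟨a, ⟨ha1, ha2⟩, rfl⟩
      exact ⟨U₀ a, ⟨aeval_mem_resonantSubmodule ub hres _ a ha1, hU a ha2⟩, rfl⟩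
    · exact ⟨_, ⟨X_mem_resonantSubmodule mu k, hXI k⟩, rfl⟩
  choose φ hφ1 hφ2 using hφ
  choose g hg hgφ using fun k => hφ2 k 1
  have hΦ : ∀ k, ∃ P : Polynomial (MvPolynomial (Fin n) ℂ), P.map π.toRingHom = φ k :=
    fun k => Polynomial.map_surjective π.toRingHom hπ (φ k)
  choose Φ hΦ using hΦ
  have hcoeff : ∀ k i, π ((Φ k).coeff i) = (φ k).coeff i := by
    intro k i
    rw [← hΦ, Polynomial.coeff_map]; rfl
  have heval : ∀ k (m : ℕ), π ((Φ k).eval (m : MvPolynomial (Fin n) ℂ)) = π ((U₀ ^ m) (MvPolynomial.X k)) := by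
    intro k m
    rw [← hUm, ← hφ1, ← hΦ]
    have h1 : (m : MvPolynomial (Fin n) ℂ ⧸ J) = π.toRingHom (m : MvPolynomial (Fin n) ℂ) := by simp
    rw [h1, Polynomial.eval_map_apply]
    rfl
  refine ⟨g, Φ, fun k => (hg k).1, fun k => ?_, fun k i => ?_, fun k i => ?_, fun k => ?_,
    fun k => ?_⟩
  · refine sub_linear_mem_sq _ (hg k).2 fun l => ?_
    have h1 : g k - (Φ k).coeff 1 ∈ I ^ 2 := hJ2 ((hker _ _).1 ((hgφ k).trans (hcoeff k 1).symm))
    rw [coeff_single_eq_of_sub_mem_sq h1]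
    -- The coefficient of `y_l` in `Φ_k(t)`, as a polynomial in `t`; at `t = m` it is an entry of
    -- `exp(N)^m`.
    set q : Polynomial ℂ := ∑ i ∈ Finset.range ((Φ k).natDegree + 1),
      Polynomial.C (((Φ k).coeff i).coeff (Finsupp.single l 1)) * Polynomial.X ^ i with hq
    have hq1 : q.coeff 1 = ((Φ k).coeff 1).coeff (Finsupp.single l 1) := by
      rw [hq, Polynomial.finsetSum_coeff]
      simp only [Polynomial.coeff_C_mul, Polynomial.coeff_X_pow]
      by_cases hi : 1 < (Φ k).natDegree + 1
      · rw [Finset.sum_eq_single 1]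
        · simp
        · intro b _ hb
          rw [if_neg (Ne.symm hb), mul_zero]
        · intro h; exact absurd (Finset.mem_range.2 hi) h
      · rw [Polynomial.coeff_eq_zero_of_natDegree_lt (p := Φ k) (by omega), MvPolynomial.coeff_zero]
        apply Finset.sum_eq_zero
        intro b hb
        rw [if_neg, mul_zero]
        rintro rfl
        exact hi (Finset.mem_range.1 hb)
    rw [← hq1]
    refine coeff_one_eq_of_eval_natCast_eq_exp N hN k l fun m => ?_
    have h2 : q.eval (m : ℂ) = ((Φ k).eval (m : MvPolynomial (Fin n) ℂ)).coeff (Finsupp.single l 1) := by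
      rw [hq, Polynomial.eval_finsetSum, Polynomial.eval_eq_sum_range, MvPolynomial.coeff_sum]
      refine Finset.sum_congr rfl fun i _ => ?_
      have h3 : ((m : MvPolynomial (Fin n) ℂ)) ^ i = MvPolynomial.C ((m : ℂ) ^ i) := by simp
      rw [h3, mul_comm _ (MvPolynomial.C _), MvPolynomial.coeff_C_mul,
        Polynomial.eval_mul, Polynomial.eval_C, Polynomial.eval_pow, Polynomial.eval_X]
      ring
    rw [h2, coeff_single_eq_of_sub_mem_sq (hJ2 ((hker _ _).1 (heval k m)))]
    have hlin' : ∀ k, U₀.toLinearMap (MvPolynomial.X k)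
        - ∑ l, NormedSpace.exp N k l • MvPolynomial.X l ∈ I ^ 2 := by
      intro k
      have : U₀.toLinearMap (MvPolynomial.X k) = ub k := MvPolynomial.aeval_X ub k
      rw [this]
      exact hlin k
    have h4 := pow_apply_X_sub_mem U₀.toLinearMap (fun a ha => map_mem_pow U₀ I hU 2 a ha) _ hlin' m k
    have h5 : ((U₀ ^ m) (MvPolynomial.X k)) = (U₀.toLinearMap ^ m) (MvPolynomial.X k) := by
      have : ∀ a, (U₀ ^ m) a = (U₀.toLinearMap ^ m) a := by
        clear h2 h4
        induction m with
        | zero => intro a; simp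
        | succ m ih =>
          intro a
          rw [pow_succ, pow_succ, AlgHom.mul_apply, Module.End.mul_apply, ih]; rfl
      exact this _
    rw [h5, coeff_single_eq_of_sub_mem_sq h4, coeff_single_linear]
  · obtain ⟨a, ha, ha'⟩ := hφ2 k i
    have h1 : (Φ k).coeff i - a ∈ J := (hker _ _).1 ((hcoeff k i).trans ha'.symm)
    have := I.add_mem (hJ1 h1) ha.2
    simpa using this
  · rw [← sub_zero (Polynomial.coeff _ i), ← hker, map_zero]
    have h1 : MvPolynomial.aeval (fun k => π (MvPolynomial.X k)) (g k) = (φ k).coeff 1 := by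
      rw [← hgφ, ← MvPolynomial.comp_aeval_apply, MvPolynomial.aeval_X_left]; rfl
    have h2 := derivative_eq_aeval_of_interpolation U _ φ hφ1 (g k) k h1
    have h3 : (Polynomial.derivative (Φ k) - MvPolynomial.aeval Φ (g k)).map π.toRingHom = 0 := by
      rw [Polynomial.map_sub, ← Polynomial.derivative_map, hΦ, h2, sub_eq_zero]
      have h4 := MvPolynomial.comp_aeval_apply (R := ℂ) (B := Polynomial (MvPolynomial (Fin n) ℂ ⧸ J)) Φ
        (Polynomial.mapAlgHom π) (g k)
      have h5 : (fun k => Polynomial.mapAlgHom π (Φ k)) = φ := funext hΦ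
      rw [h5] at h4
      exact h4.symm
    have h6 := congrArg (fun p => Polynomial.coeff p i) h3
    simpa [Polynomial.coeff_map] using h6
  · have := heval k 0
    rw [hker] at this
    simpa using this
  · have := heval k 1
    rw [hker] at this
    simpa [hU₀] using this

/-! ### Jets of formal maps as polynomials -/

/-- The terms of degree `≤ ν` of the formal map `f`. -/
def FormalMap.jet (f : FormalMap n) (ν : ℕ) (k : Fin n) : MvPolynomial (Fin n) ℂ :=
  ∑ d ∈ Finset.range (ν + 1), ∑ j ∈ Finset.finsuppAntidiag (Finset.univ : Finset (Fin n)) d,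
    MvPolynomial.monomial j (f.coef j k)

theorem FormalMap.coeff_jet (f : FormalMap n) (ν : ℕ) (k : Fin n) (j : Fin n →₀ ℕ) :
    (f.jet ν k).coeff j = if j.degree < ν + 1 then f.coef j k else 0 := by
  classical
  simp only [FormalMap.jet, MvPolynomial.coeff_sum, MvPolynomial.coeff_monomial]
  have h : ∀ d, (∑ i ∈ Finset.finsuppAntidiag (Finset.univ : Finset (Fin n)) d,
      if i = j then f.coef i k else 0) = if j.degree = d then f.coef j k else 0 := by
    intro d
    rw [Finset.sum_ite_eq']
    refine if_congr ?_ rfl rfl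
    rw [Finset.mem_finsuppAntidiag, Finsupp.degree_eq_sum]
    simp
  simp only [h]
  rw [Finset.sum_ite_eq]
  simp

theorem FormalMap.eval_jet (f : FormalMap n) (ν : ℕ) (k : Fin n) (y : Fin n → ℂ) :
    MvPolynomial.eval y (f.jet ν k) = f.taylor ν y k := by
  simp only [FormalMap.jet, FormalMap.taylor, map_sum, MvPolynomial.eval_monomial]
  refine Finset.sum_congr rfl fun d _ => Finset.sum_congr rfl fun j _ => ?_
  rw [Finsupp.prod_fintype _ _ (by simp)]

theorem FormalMap.jet_mem_idealOfVars (f : FormalMap n)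
    (hf : ∀ k, MvPowerSeries.constantCoeff (f k) = 0) (ν : ℕ) (k : Fin n) :
    f.jet ν k ∈ MvPolynomial.idealOfVars (Fin n) ℂ := by
  rw [← pow_one (MvPolynomial.idealOfVars (Fin n) ℂ), MvPolynomial.mem_pow_idealOfVars_iff']
  intro j hj
  obtain rfl : j = 0 := (Finsupp.degree_eq_zero_iff j).1 (by omega)
  rw [FormalMap.coeff_jet]
  split_ifs
  · exact hf k
  · rfl

theorem FormalMap.jet_sub_linearPart_mem (f : FormalMap n)
    (hf : ∀ k, MvPowerSeries.constantCoeff (f k) = 0) {ν : ℕ} (hν : 1 ≤ ν) (k : Fin n) :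
    f.jet ν k - ∑ l, f.linearPart k l • MvPolynomial.X l
      ∈ MvPolynomial.idealOfVars (Fin n) ℂ ^ 2 := by
  refine sub_linear_mem_sq _ (f.jet_mem_idealOfVars hf ν k) fun l => ?_
  rw [FormalMap.coeff_jet, if_pos (by rw [Finsupp.degree_single]; omega)]
  rfl

theorem FormalMap.jet_sub_jet_mem (f : FormalMap n) {ν ν' : ℕ} (h : ν ≤ ν') (k : Fin n) :
    f.jet ν' k - f.jet ν k ∈ MvPolynomial.idealOfVars (Fin n) ℂ ^ (ν + 1) := by
  rw [MvPolynomial.mem_pow_idealOfVars_iff']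
  intro j hj
  rw [MvPolynomial.coeff_sub, FormalMap.coeff_jet, FormalMap.coeff_jet, if_pos hj,
    if_pos (by omega), sub_self]

/-! ### Coefficients of the unipotent part -/

theorem coef_diagonalMap_comp (lam : Fin n → ℂ) (u : FormalMap n)
    (hu : ∀ k, MvPowerSeries.constantCoeff (u k) = 0) (j : Fin n →₀ ℕ) (k : Fin n) :
    ((diagonalMap lam).comp u).coef j k = lam k * u.coef j k := by
  have hs : MvPowerSeries.HasSubst u := MvPowerSeries.hasSubst_of_constantCoeff_zero hu
  have h1 : ((diagonalMap lam).comp u) k = lam k • u k := by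
    rw [FormalMap.comp, diagonalMap, ← MvPowerSeries.smul_eq_C_mul, MvPowerSeries.subst_smul hs,
      MvPowerSeries.subst_X hs]
  rw [FormalMap.coef, h1]
  rfl

theorem coef_comp_diagonalMap (lam : Fin n → ℂ) (u : FormalMap n) (j : Fin n →₀ ℕ) (k : Fin n) :
    (u.comp (diagonalMap lam)).coef j k = (∏ l, lam l ^ j l) * u.coef j k := by
  have h1 : (diagonalMap lam : FormalMap n) = lam • MvPowerSeries.X := by
    funext l
    rw [diagonalMap, Pi.smul_apply', MvPowerSeries.smul_eq_C_mul]
  rw [FormalMap.coef, FormalMap.comp, h1, ← MvPowerSeries.rescale_eq_subst,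
    MvPowerSeries.coeff_rescale, Finsupp.prod_fintype _ _ (by simp)]
  rfl

theorem coef_eq_mul_of_isJordanChevalley {f u : FormalMap n} {lam : Fin n → ℂ}
    (h : IsJordanChevalley f (diagonalMap lam) u) (j : Fin n →₀ ℕ) (k : Fin n) :
    f.coef j k = lam k * u.coef j k := by
  conv_lhs => rw [h.eq_comp]
  exact coef_diagonalMap_comp lam u h.diffeo_u.constantCoeff_eq_zero j k

/-- Comparing coefficients in `f_s ∘ u = u ∘ f_s` gives `lam_k = ∏ lam_l^(j_l)`; take logarithms. -/
theorem exists_int_resonanceNumber {f u : FormalMap n} {mu : Fin n → ℂ}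
    (h : IsJordanChevalley f
      (diagonalMap fun k => Complex.exp (2 * Real.pi * Complex.I * mu k)) u)
    (j : Fin n →₀ ℕ) (k : Fin n) (hj : u.coef j k ≠ 0) :
    ∃ m : ℤ, resonanceNumber mu j k = m := by
  have h1 := coef_eq_mul_of_isJordanChevalley h j k
  have h2 : f.coef j k
      = (∏ l, Complex.exp (2 * Real.pi * Complex.I * mu l) ^ j l) * u.coef j k := by
    conv_lhs => rw [h.eq_comp']
    exact coef_comp_diagonalMap _ u j k
  have h3 := mul_right_cancel₀ hj (h1.symm.trans h2)
  have h4 : ∏ l, Complex.exp (2 * Real.pi * Complex.I * mu l) ^ j l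
      = Complex.exp (2 * Real.pi * Complex.I * ∑ l, (j l : ℂ) * mu l) := by
    rw [Finset.mul_sum, Complex.exp_sum]
    refine Finset.prod_congr rfl fun l _ => ?_
    rw [← Complex.exp_nat_mul]
    ring_nf
  rw [h4, Complex.exp_eq_exp_iff_exists_int] at h3
  obtain ⟨m, hm⟩ := h3
  refine ⟨m, ?_⟩
  rw [resonanceNumber]
  have hpi : (2 * Real.pi * Complex.I : ℂ) ≠ 0 := Complex.two_pi_I_ne_zero
  apply mul_left_cancel₀ hpi
  linear_combination hm

theorem linearPart_eq_exp_nilpotent {f u : FormalMap n} {A N : Matrix (Fin n) (Fin n) ℂ}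
    {mu : Fin n → ℂ} (hlin : f.linearPart = NormedSpace.exp ((2 * Real.pi * Complex.I : ℂ) • A))
    (hA : IsAdditiveJordan A (Matrix.diagonal mu) N)
    (h : IsJordanChevalley f
      (diagonalMap fun k => Complex.exp (2 * Real.pi * Complex.I * mu k)) u) :
    u.linearPart = NormedSpace.exp ((2 * Real.pi * Complex.I : ℂ) • N) := by
  have hc : Commute ((2 * Real.pi * Complex.I : ℂ) • Matrix.diagonal mu)
      ((2 * Real.pi * Complex.I : ℂ) • N) :=
    (Commute.smul_left (Commute.smul_right hA.commute _) _)
  rw [hA.add_eq, smul_add, Matrix.exp_add_of_commute _ _ hc, ← Matrix.diagonal_smul,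
    Matrix.exp_diagonal] at hlin
  ext k l
  have h1 := congrFun (congrFun hlin k) l
  rw [Matrix.diagonal_mul, Pi.coe_exp, ← Complex.exp_eq_exp_ℂ] at h1
  have h2 : f.linearPart k l
    = Complex.exp (2 * Real.pi * Complex.I * mu k) * u.linearPart k l :=
    coef_eq_mul_of_isJordanChevalley h _ k
  rw [h2] at h1
  exact mul_left_cancel₀ (Complex.exp_ne_zero _) h1

theorem commute_diagonal_apply {N : Matrix (Fin n) (Fin n) ℂ} {mu : Fin n → ℂ}
    (h : Matrix.diagonal mu * N = N * Matrix.diagonal mu) {k l : Fin n} (hkl : N k l ≠ 0) :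
    mu k = mu l := by
  have h1 := congrFun (congrFun h k) l
  rw [Matrix.diagonal_mul, Matrix.mul_diagonal, mul_comm] at h1
  exact mul_left_cancel₀ hkl h1

/-- In degree one, `du(0) = exp(2πi N)` commutes with `diag(mu)`, so the resonance number is `0`. In
degree at least two it is an integer, and not negative because `f` and `u` have the same monomials.
-/
theorem jet_mem_resonantSubmodule {f u : FormalMap n} {A N : Matrix (Fin n) (Fin n) ℂ}
    {mu : Fin n → ℂ} (hlin : f.linearPart = NormedSpace.exp ((2 * Real.pi * Complex.I : ℂ) • A))
    (hA : IsAdditiveJordan A (Matrix.diagonal mu) N)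
    (h : IsJordanChevalley f
      (diagonalMap fun k => Complex.exp (2 * Real.pi * Complex.I * mu k)) u)
    (hres : HasNoNegativeResonances f mu) (ν : ℕ) (k : Fin n) :
    u.jet ν k ∈ resonantSubmodule mu (mu k) := by
  rw [mem_resonantSubmodule]
  intro j hj
  rw [MvPolynomial.mem_support_iff, FormalMap.coeff_jet] at hj
  have hj0 : u.coef j k ≠ 0 := by
    intro h0; rw [h0, ite_self] at hj; exact hj rfl
  rcases Nat.lt_or_ge j.degree 2 with hd | hd
  · have hd' : j.degree = 0 ∨ j.degree = 1 := by omega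
    rcases hd' with hd' | hd'
    · obtain rfl : j = 0 := (Finsupp.degree_eq_zero_iff j).1 hd'
      exact absurd (h.diffeo_u.constantCoeff_eq_zero k) hj0
    · obtain ⟨l, rfl⟩ := exists_eq_single_of_degree_eq_one hd'
      have h1 : u.linearPart k l ≠ 0 := hj0
      rw [linearPart_eq_exp_nilpotent hlin hA h] at h1
      have hc : Commute (Matrix.diagonal mu)
          (NormedSpace.exp ((2 * Real.pi * Complex.I : ℂ) • N)) := by
        obtain ⟨r, hr⟩ := hA.nilpotent
        rw [exp_smul_eq_sum_of_pow_eq_zero N hr]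
        exact Commute.sum_right _ _ _ fun i _ =>
          Commute.smul_right (Commute.pow_right hA.commute i) _
      have h2 := commute_diagonal_apply hc h1
      obtain ⟨m, hm⟩ := mem_resonantSubmodule.1 (X_mem_resonantSubmodule mu l)
        (Finsupp.single l 1) (by simp [MvPolynomial.support_X])
      exact ⟨m, by rw [h2]; exact hm⟩
  · obtain ⟨m, hm⟩ := exists_int_resonanceNumber h j k hj0
    have hf0 : f.coef j k ≠ 0 := by
      rw [coef_eq_mul_of_isJordanChevalley h]
      exact mul_ne_zero (Complex.exp_ne_zero _) hj0
    have hm0 : 0 ≤ m := by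
      by_contra hneg
      exact hres j k hf0 ⟨hd, m, by omega, hm⟩
    lift m to ℕ using hm0
    exact ⟨m, by rw [← Int.cast_natCast, ← hm]; rfl⟩

open Asymptotics

/-! ### Growth of polynomials at the origin -/

section Growth

variable {B : Type*} [NormedCommRing B] [NormedAlgebra ℂ B]

theorem continuous_aeval_mvPolynomial (p : MvPolynomial (Fin n) ℂ) :
    Continuous fun x : Fin n → B => MvPolynomial.aeval x p := by
  have h : AnalyticOnNhd ℂ (fun x : Fin n → B => MvPolynomial.aeval x p) Set.univ :=
    fun x _ => AnalyticAt.aeval_mvPolynomial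
      (fun i => (ContinuousLinearMap.proj (R := ℂ) (φ := fun _ : Fin n => B) i).analyticAt x) p
  exact continuousOn_univ.1 h.continuousOn

/-- The general algebra `B` serves both points (`B = ℂ`) and curves (`B = C([0,1], ℂ)`). -/
theorem isBigO_aeval_of_mem_pow (d : ℕ) (p : MvPolynomial (Fin n) ℂ)
    (hp : p ∈ MvPolynomial.idealOfVars (Fin n) ℂ ^ d) :
    (fun x : Fin n → B => MvPolynomial.aeval x p) =O[𝓝 0] fun x => ‖x‖ ^ d := by
  have h0 : ∀ p : MvPolynomial (Fin n) ℂ,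
      (fun x : Fin n → B => MvPolynomial.aeval x p) =O[𝓝 0] fun _ => (1 : ℝ) :=
    fun p => ((continuous_aeval_mvPolynomial p).tendsto 0).isBigO_one ℝ
  induction d generalizing p with
  | zero => simpa only [pow_zero] using h0 p
  | succ d ih =>
    rw [pow_succ] at hp
    induction hp using Submodule.mul_induction_on' with
    | mem_mul_mem a ha b hb =>
      simp only [map_mul, pow_succ]
      refine (ih a ha).mul ?_
      induction hb using Submodule.span_induction with
      | mem x hx =>
        obtain ⟨k, rfl⟩ := hx
        simp only [MvPolynomial.aeval_X]
        exact IsBigO.of_bound 1 (Eventually.of_forall fun x => by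
          simpa using norm_le_pi_norm x k)
      | zero => simpa using isBigO_zero _ _
      | add x y _ _ hx hy => simpa using hx.add hy
      | smul c x _ hx => simpa using (h0 c).mul hx
    | add a _ b _ ha hb => simpa using ha.add hb

theorem hasFDerivAt_aeval_of_sub_mem_sq (g : MvPolynomial (Fin n) ℂ) (c : Fin n → ℂ)
    (h : g - ∑ l, c l • MvPolynomial.X l ∈ MvPolynomial.idealOfVars (Fin n) ℂ ^ 2) :
    HasFDerivAt (fun x : Fin n → B => MvPolynomial.aeval x g)
      (∑ l, c l • ContinuousLinearMap.proj (R := ℂ) (φ := fun _ : Fin n => B) l) 0 := by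
  have h1 := isBigO_aeval_of_mem_pow (B := B) 2 _ h
  have h2 : HasFDerivAt (fun x : Fin n → B =>
      MvPolynomial.aeval x (g - ∑ l, c l • MvPolynomial.X l)) (0 : (Fin n → B) →L[ℂ] B) 0 :=
    IsBigO.hasFDerivAt (n := 2) (by simpa using h1) (by norm_num)
  have h3 := h2.add (∑ l, c l • ContinuousLinearMap.proj (R := ℂ)
    (φ := fun _ : Fin n => B) l).hasFDerivAt
  rw [zero_add] at h3
  refine h3.congr_of_eventuallyEq (Eventually.of_forall fun x => ?_)
  simp

end Growth

/-! ### Integration on the space of curves -/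

/-- The antiderivative `γ ↦ (t ↦ ∫₀ᵗ γ)` on the space of continuous curves. -/
def primitive : C(Set.Icc (0 : ℝ) 1, ℂ) →L[ℂ] C(Set.Icc (0 : ℝ) 1, ℂ) :=
  LinearMap.mkContinuous
    { toFun := fun γ =>
        { toFun := fun t => ∫ s in (0 : ℝ)..t, γ (Set.projIcc 0 1 zero_le_one s)
          continuous_toFun := (intervalIntegral.continuous_primitive (fun a b =>
            (γ.continuous.comp continuous_projIcc).intervalIntegrable a b) 0).comp
              continuous_subtype_val }
      map_add' := fun γ δ => by
        ext t
        exact intervalIntegral.integral_add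
          ((γ.continuous.comp continuous_projIcc).intervalIntegrable _ _)
          ((δ.continuous.comp continuous_projIcc).intervalIntegrable _ _)
      map_smul' := fun c γ => by
        ext t
        exact intervalIntegral.integral_smul c _ }
    1 (fun γ => by
      rw [one_mul]
      refine (ContinuousMap.norm_le _ (norm_nonneg _)).2 fun t => ?_
      refine (intervalIntegral.norm_integral_le_of_norm_le_const (C := ‖γ‖)
        fun s _ => γ.norm_coe_le_norm _).trans ?_
      rw [sub_zero, abs_of_nonneg t.2.1]
      exact mul_le_of_le_one_right (norm_nonneg _) t.2.2)

theorem primitive_apply (γ : C(Set.Icc (0 : ℝ) 1, ℂ)) (t : Set.Icc (0 : ℝ) 1) :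
    primitive γ t = ∫ s in (0 : ℝ)..t, γ (Set.projIcc 0 1 zero_le_one s) := rfl

/-- The map `γ ↦ γ - ∫ g(γ)`: the curve `γ` solves `γ' = g(γ)` if and only if its image is the
constant curve `γ(0)`. -/
def integralMap (g : Fin n → MvPolynomial (Fin n) ℂ) (γ : Fin n → C(Set.Icc (0 : ℝ) 1, ℂ)) :
    Fin n → C(Set.Icc (0 : ℝ) 1, ℂ) :=
  fun k => γ k - primitive (MvPolynomial.aeval γ (g k))

/-! ### Linearization and local inversion of the integral equation -/

section Volterra

variable {E : Type*} [NormedAddCommGroup E] [NormedSpace ℂ E] (P : E →L[ℂ] E)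

/-- The Volterra operator `(γ_k) ↦ (P (∑ N_kl γ_l))` of the linear system of matrix `N`, where
`P` is an antiderivative. -/
def volterra (N : Matrix (Fin n) (Fin n) ℂ) : (Fin n → E) →L[ℂ] (Fin n → E) :=
  ContinuousLinearMap.pi fun k => P ∘L
    ∑ l, N k l • ContinuousLinearMap.proj (R := ℂ) (φ := fun _ : Fin n => E) l

theorem volterra_pow_apply (N : Matrix (Fin n) (Fin n) ℂ) (m : ℕ) (γ : Fin n → E) (k : Fin n) :
    (volterra P N ^ m) γ k = (P ^ m) (∑ l, (N ^ m) k l • γ l) := by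
  induction m generalizing γ with
  | zero => simp [Matrix.one_apply]
  | succ m ih =>
    rw [pow_succ, mul_apply_eq_comp, ih, pow_succ P, mul_apply_eq_comp]
    congr 1
    have h : ∀ l, volterra P N γ l = P (∑ i, N l i • γ i) := by
      intro l
      simp [volterra]
    simp only [h, ← map_smul, ← map_sum]
    congr 1
    simp only [Finset.smul_sum, smul_smul]
    rw [Finset.sum_comm]
    simp only [pow_succ, Matrix.mul_apply, Finset.sum_smul]

/-- `P` acts componentwise and commutes with the scalar matrix, so `N^r = 0` kills the `r`-th power.
No smallness of `N` or of the time interval is needed. -/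
theorem isUnit_one_sub_volterra {N : Matrix (Fin n) (Fin n) ℂ} (hN : IsNilpotent N) :
    IsUnit (1 - volterra P N) := by
  apply IsNilpotent.isUnit_one_sub
  obtain ⟨r, hr⟩ := hN
  refine ⟨r, ?_⟩
  ext γ k
  rw [volterra_pow_apply, hr]
  simp

end Volterra

theorem analyticAt_integralMap (g : Fin n → MvPolynomial (Fin n) ℂ)
    (γ : Fin n → C(Set.Icc (0 : ℝ) 1, ℂ)) : AnalyticAt ℂ (integralMap g) γ := by
  refine AnalyticAt.pi fun k => ?_
  have hproj : ∀ i, AnalyticAt ℂ (fun γ : Fin n → C(Set.Icc (0 : ℝ) 1, ℂ) => γ i) γ := fun i =>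
    (ContinuousLinearMap.proj (R := ℂ) (φ := fun _ : Fin n => C(Set.Icc (0 : ℝ) 1, ℂ)) i).analyticAt γ
  exact (hproj k).sub ((primitive.analyticAt _).comp
    (AnalyticAt.aeval_mvPolynomial hproj (g k)))

theorem hasFDerivAt_integralMap (g : Fin n → MvPolynomial (Fin n) ℂ)
    (N : Matrix (Fin n) (Fin n) ℂ)
    (hg : ∀ k, g k - ∑ l, N k l • MvPolynomial.X l ∈ MvPolynomial.idealOfVars (Fin n) ℂ ^ 2) :
    HasFDerivAt (integralMap g) (1 - volterra primitive N) 0 := by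
  rw [hasFDerivAt_pi']
  intro k
  have h1 := hasFDerivAt_aeval_of_sub_mem_sq (B := C(Set.Icc (0 : ℝ) 1, ℂ)) (g k) (N k) (hg k)
  have h2 := (primitive.hasFDerivAt (x := MvPolynomial.aeval
    (0 : Fin n → C(Set.Icc (0 : ℝ) 1, ℂ)) (g k))).comp (0 : Fin n → C(Set.Icc (0 : ℝ) 1, ℂ)) h1
  have h3 := (ContinuousLinearMap.proj (R := ℂ)
    (φ := fun _ : Fin n => C(Set.Icc (0 : ℝ) 1, ℂ)) k).hasFDerivAt
      (x := (0 : Fin n → C(Set.Icc (0 : ℝ) 1, ℂ)))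
  exact h3.sub h2

theorem integralMap_zero (g : Fin n → MvPolynomial (Fin n) ℂ)
    (hg : ∀ k, g k ∈ MvPolynomial.idealOfVars (Fin n) ℂ) : integralMap g 0 = 0 := by
  funext k
  have h1 := isBigO_aeval_of_mem_pow (B := C(Set.Icc (0 : ℝ) 1, ℂ)) 1 (g k) (by simpa using hg k)
  have h2 : MvPolynomial.aeval (0 : Fin n → C(Set.Icc (0 : ℝ) 1, ℂ)) (g k) = 0 := by
    simpa using h1.eq_zero_imp.self_of_nhds
  simp [integralMap, h2]

/-- Applied to a constant curve `y`, `Ψ` yields the solution of `γ' = g(γ)` starting at `y`, over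
the whole unit interval and analytic in `y`. -/
theorem exists_analytic_inverse_integralMap (g : Fin n → MvPolynomial (Fin n) ℂ)
    (N : Matrix (Fin n) (Fin n) ℂ) (hN : IsNilpotent N)
    (hg0 : ∀ k, g k ∈ MvPolynomial.idealOfVars (Fin n) ℂ)
    (hg : ∀ k, g k - ∑ l, N k l • MvPolynomial.X l ∈ MvPolynomial.idealOfVars (Fin n) ℂ ^ 2) :
    ∃ Ψ : (Fin n → C(Set.Icc (0 : ℝ) 1, ℂ)) → (Fin n → C(Set.Icc (0 : ℝ) 1, ℂ)),
      Ψ 0 = 0 ∧ AnalyticAt ℂ Ψ 0 ∧ (∀ᶠ η in 𝓝 0, integralMap g (Ψ η) = η) ∧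
      ∀ᶠ γ in 𝓝 0, Ψ (integralMap g γ) = γ := by
  obtain ⟨e, he⟩ := isUnit_one_sub_volterra primitive hN
  have h1 : HasFDerivAt (integralMap g) ((ContinuousLinearEquiv.ofUnit e :
      (Fin n → C(Set.Icc (0 : ℝ) 1, ℂ)) ≃L[ℂ] (Fin n → C(Set.Icc (0 : ℝ) 1, ℂ))) :
      (Fin n → C(Set.Icc (0 : ℝ) 1, ℂ)) →L[ℂ] (Fin n → C(Set.Icc (0 : ℝ) 1, ℂ))) 0 := by
    have := hasFDerivAt_integralMap g N hg
    rw [← he] at this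
    exact this
  have h2 : ContDiffAt ℂ ⊤ (integralMap g) 0 := (analyticAt_integralMap g 0).contDiffAt
  -- Here `⊤` is analytic regularity, so the local inverse is analytic.
  have hn : (⊤ : WithTop ℕ∞) ≠ 0 := by simp
  have h0 := integralMap_zero g hg0
  refine ⟨h2.localInverse h1 hn, ?_, ?_, ?_, ?_⟩
  · have := h2.localInverse_apply_image h1 hn
    rwa [h0] at this
  · have := h2.to_localInverse h1 hn
    rw [h0] at this
    exact this.analyticAt
  · have := (h2.hasStrictFDerivAt' h1 hn).eventually_right_inverse
    rw [h0] at this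
    exact this
  · exact (h2.hasStrictFDerivAt' h1 hn).eventually_left_inverse

/-! ### Curves with polynomial dependence on time -/

/-- The curve `t ↦ P(t)(y)`, `t ∈ [0, 1]`, where `P` is a polynomial in `t` with coefficients in
`ℂ[y]`. -/
def polynomialCurve (y : Fin n → ℂ) :
    Polynomial (MvPolynomial (Fin n) ℂ) →ₐ[ℂ] C(Set.Icc (0 : ℝ) 1, ℂ) :=
  Polynomial.eval₂AlgHom ((Algebra.ofId ℂ C(Set.Icc (0 : ℝ) 1, ℂ)).comp (MvPolynomial.aeval y))
    ⟨fun t => ((t : ℝ) : ℂ), by fun_prop⟩ (fun _ => Commute.all _ _)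

theorem polynomialCurve_eq_sum (y : Fin n → ℂ) (P : Polynomial (MvPolynomial (Fin n) ℂ)) :
    polynomialCurve y P = ∑ i ∈ Finset.range (P.natDegree + 1),
      algebraMap ℂ C(Set.Icc (0 : ℝ) 1, ℂ) (MvPolynomial.aeval y (P.coeff i))
        * (⟨fun t => ((t : ℝ) : ℂ), by fun_prop⟩ : C(Set.Icc (0 : ℝ) 1, ℂ)) ^ i := by
  rw [polynomialCurve, Polynomial.eval₂AlgHom_apply, Polynomial.eval₂_eq_sum_range]
  rfl

theorem polynomialCurve_apply (y : Fin n → ℂ) (P : Polynomial (MvPolynomial (Fin n) ℂ))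
    (t : Set.Icc (0 : ℝ) 1) :
    polynomialCurve y P t = (P.map (MvPolynomial.eval y)).eval ((t : ℝ) : ℂ) := by
  rw [polynomialCurve_eq_sum, Polynomial.eval_map, Polynomial.eval₂_eq_sum_range,
    ContinuousMap.sum_apply]
  rfl

theorem isBigO_polynomialCurve (d : ℕ) (P : Polynomial (MvPolynomial (Fin n) ℂ))
    (hP : ∀ i, P.coeff i ∈ MvPolynomial.idealOfVars (Fin n) ℂ ^ d) :
    (fun y : Fin n → ℂ => polynomialCurve y P) =O[𝓝 0] fun y => ‖y‖ ^ d := by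
  simp only [polynomialCurve_eq_sum]
  refine IsBigO.fun_sum fun i _ => ?_
  have h1 : (fun y : Fin n → ℂ => algebraMap ℂ C(Set.Icc (0 : ℝ) 1, ℂ)
      (MvPolynomial.aeval y (P.coeff i))) =O[𝓝 0] fun y => ‖y‖ ^ d := by
    refine IsBigO.trans (IsBigO.of_bound 1 (Eventually.of_forall fun y => ?_))
      (isBigO_aeval_of_mem_pow (B := ℂ) d _ (hP i))
    rw [one_mul, norm_algebraMap']
  simpa using h1.mul (isBigO_const_const
    ((⟨fun t => ((t : ℝ) : ℂ), by fun_prop⟩ : C(Set.Icc (0 : ℝ) 1, ℂ)) ^ i) (one_ne_zero (α := ℝ))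
      (𝓝 (0 : Fin n → ℂ)))

theorem primitive_polynomialCurve_derivative (y : Fin n → ℂ)
    (P : Polynomial (MvPolynomial (Fin n) ℂ)) :
    primitive (polynomialCurve y (Polynomial.derivative P))
      = polynomialCurve y P - algebraMap ℂ _ (MvPolynomial.eval y (P.eval 0)) := by
  ext t
  rw [primitive_apply, ContinuousMap.sub_apply, polynomialCurve_apply]
  set p := P.map (MvPolynomial.eval y) with hp
  have h1 : ∫ s in (0 : ℝ)..t, polynomialCurve y (Polynomial.derivative P)
      (Set.projIcc 0 1 zero_le_one s) = ∫ s in (0 : ℝ)..t, (Polynomial.derivative p).eval (s : ℂ) := by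
    refine intervalIntegral.integral_congr fun s hs => ?_
    rw [Set.uIcc_of_le t.2.1] at hs
    have hs' : s ∈ Set.Icc (0 : ℝ) 1 := ⟨hs.1, hs.2.trans t.2.2⟩
    simp only [polynomialCurve_apply, Set.projIcc_of_mem zero_le_one hs', hp,
      Polynomial.derivative_map]
  have h2 : ∀ s ∈ Set.uIcc (0 : ℝ) t,
      HasDerivAt (fun s : ℝ => p.eval (s : ℂ)) ((Polynomial.derivative p).eval (s : ℂ)) s :=
    fun s _ => (p.hasDerivAt (s : ℂ)).comp_ofReal
  rw [h1, intervalIntegral.integral_eq_sub_of_hasDerivAt h2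
    (Continuous.intervalIntegrable (by fun_prop) _ _)]
  congr 1
  have h3 : (0 : ℂ) = MvPolynomial.eval y (0 : MvPolynomial (Fin n) ℂ) := by simp
  rw [hp, Complex.ofReal_zero, h3, Polynomial.eval_map_apply]
  rfl

/-! ### Time-one maps -/

theorem algebraMap_curve_apply (c : ℂ) (t : Set.Icc (0 : ℝ) 1) :
    algebraMap ℂ C(Set.Icc (0 : ℝ) 1, ℂ) c t = c := rfl

theorem hasDerivWithinAt_of_integralMap_eq (g : Fin n → MvPolynomial (Fin n) ℂ)
    (γ : Fin n → C(Set.Icc (0 : ℝ) 1, ℂ)) (y : Fin n → ℂ)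
    (h : integralMap g γ = fun k => algebraMap ℂ C(Set.Icc (0 : ℝ) 1, ℂ) (y k)) :
    (fun k => γ k (Set.projIcc 0 1 zero_le_one 0)) = y ∧ ∀ t ∈ Set.Icc (0 : ℝ) 1,
      HasDerivWithinAt (fun (s : ℝ) k => γ k (Set.projIcc 0 1 zero_le_one s))
        (fun k => MvPolynomial.eval (fun l => γ l (Set.projIcc 0 1 zero_le_one t)) (g k))
        (Set.Icc 0 1) t := by
  have haeval : ∀ k t, (MvPolynomial.aeval γ (g k)) t
      = MvPolynomial.eval (fun l => γ l t) (g k) := by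
    intro k t
    have := MvPolynomial.comp_aeval_apply (R := ℂ) γ (ContinuousMap.evalAlgHom ℂ ℂ t) (g k)
    rw [MvPolynomial.aeval_eq_eval] at this
    exact this
  have hγ : ∀ k, ∀ t ∈ Set.Icc (0 : ℝ) 1, γ k (Set.projIcc 0 1 zero_le_one t)
      = y k + ∫ s in (0 : ℝ)..t, (MvPolynomial.aeval γ (g k)) (Set.projIcc 0 1 zero_le_one s) := by
    intro k t ht
    have h1 := congrArg (fun η : C(Set.Icc (0 : ℝ) 1, ℂ) => η (Set.projIcc 0 1 zero_le_one t))
      (congrFun h k)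
    simp only [integralMap, ContinuousMap.sub_apply, primitive_apply, algebraMap_curve_apply] at h1
    rw [Set.projIcc_of_mem zero_le_one ht] at h1 ⊢
    rw [← h1]
    ring
  refine ⟨funext fun k => ?_, fun t ht => ?_⟩
  · rw [hγ k 0 (by simp)]
    simp
  · rw [hasDerivWithinAt_pi]
    intro k
    have hc : Continuous fun s : ℝ => (MvPolynomial.aeval γ (g k)) (Set.projIcc 0 1 zero_le_one s) :=
      (MvPolynomial.aeval γ (g k)).continuous.comp continuous_projIcc
    have h2 := ((hc.integral_hasStrictDerivAt 0 t).hasDerivAt.const_add (y k)).hasDerivWithinAt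
      (s := Set.Icc (0 : ℝ) 1)
    rw [haeval] at h2
    exact h2.congr (fun s hs => hγ k s hs) (hγ k t ht)

theorem exists_time_one_map (g : Fin n → MvPolynomial (Fin n) ℂ)
    (N : Matrix (Fin n) (Fin n) ℂ) (hN : IsNilpotent N)
    (hg : ∀ k, g k - ∑ l, N k l • MvPolynomial.X l ∈ MvPolynomial.idealOfVars (Fin n) ℂ ^ 2)
    (Φ : Fin n → Polynomial (MvPolynomial (Fin n) ℂ)) (ν : ℕ)
    (hΦ : ∀ k i, (Φ k).coeff i ∈ MvPolynomial.idealOfVars (Fin n) ℂ)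
    (hΦ' : ∀ k i, (Polynomial.derivative (Φ k) - MvPolynomial.aeval Φ (g k)).coeff i
        ∈ MvPolynomial.idealOfVars (Fin n) ℂ ^ (ν + 1))
    (hΦ0 : ∀ k, (Φ k).eval 0 - MvPolynomial.X k ∈ MvPolynomial.idealOfVars (Fin n) ℂ ^ (ν + 1)) :
    ∃ h : (Fin n → ℂ) → (Fin n → ℂ), h 0 = 0 ∧ AnalyticAt ℂ h 0 ∧
      (∀ᶠ y in 𝓝 0, ∃ z : ℝ → Fin n → ℂ, z 0 = y ∧ z 1 = h y ∧
        ∀ t ∈ Set.Icc (0 : ℝ) 1,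
          HasDerivWithinAt z (fun k => MvPolynomial.eval (z t) (g k)) (Set.Icc 0 1) t) ∧
      (fun y => h y - fun k => MvPolynomial.eval y ((Φ k).eval 1))
        =O[𝓝 0] fun y => ‖y‖ ^ (ν + 1) := by
  have hg0 : ∀ k, g k ∈ MvPolynomial.idealOfVars (Fin n) ℂ := by
    intro k
    have h1 : ∑ l, N k l • MvPolynomial.X l ∈ MvPolynomial.idealOfVars (Fin n) ℂ :=
      Submodule.sum_mem _ fun l _ =>
        Submodule.smul_of_tower_mem _ _ (Ideal.subset_span ⟨l, rfl⟩)
    have := Ideal.add_mem _ (Ideal.pow_le_self two_ne_zero (hg k)) h1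
    simpa using this
  obtain ⟨Ψ, hΨ0, hΨa, hΨr, hΨl⟩ := exists_analytic_inverse_integralMap g N hN hg0 hg
  let c : (Fin n → ℂ) →L[ℂ] (Fin n → C(Set.Icc (0 : ℝ) 1, ℂ)) :=
    ContinuousLinearMap.pi fun k =>
      (Algebra.linearMap ℂ C(Set.Icc (0 : ℝ) 1, ℂ)).toContinuousLinearMap ∘L
        ContinuousLinearMap.proj (R := ℂ) (φ := fun _ : Fin n => ℂ) k
  have hc : ∀ y, c y = fun k => algebraMap ℂ C(Set.Icc (0 : ℝ) 1, ℂ) (y k) := fun y => rfl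
  let e : (Fin n → C(Set.Icc (0 : ℝ) 1, ℂ)) →L[ℂ] (Fin n → ℂ) :=
    ContinuousLinearMap.pi fun k =>
      (ContinuousMap.evalCLM ℂ (⟨1, by simp⟩ : Set.Icc (0 : ℝ) 1)) ∘L
        ContinuousLinearMap.proj (R := ℂ) (φ := fun _ : Fin n => C(Set.Icc (0 : ℝ) 1, ℂ)) k
  have he : ∀ γ, e γ = fun k => γ k ⟨1, by simp⟩ := fun γ => rfl
  have hc0 : Tendsto c (𝓝 0) (𝓝 0) := by
    have := c.continuous.tendsto 0
    rwa [map_zero] at this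
  refine ⟨fun y => e (Ψ (c y)), by simp [hΨ0], ?_, ?_, ?_⟩
  · have h1 : AnalyticAt ℂ Ψ (c 0) := by rwa [map_zero]
    have h2 : AnalyticAt ℂ (fun y => Ψ (c y)) 0 := h1.comp (c.analyticAt 0)
    exact (e.analyticAt _).comp h2
  · filter_upwards [hc0.eventually hΨr] with y hy
    obtain ⟨h1, h2⟩ := hasDerivWithinAt_of_integralMap_eq g (Ψ (c y)) y hy
    refine ⟨fun s k => Ψ (c y) k (Set.projIcc 0 1 zero_le_one s), h1, ?_, h2⟩
    rw [he]
    funext k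
    simp only [Set.projIcc_right]
  · set γ : (Fin n → ℂ) → (Fin n → C(Set.Icc (0 : ℝ) 1, ℂ)) :=
      fun y k => polynomialCurve y (Φ k) with hγ
    have hγO : γ =O[𝓝 0] fun y => ‖y‖ := by
      rw [isBigO_pi]
      intro k
      simpa using isBigO_polynomialCurve 1 (Φ k) (by simpa using hΦ k)
    have hnorm0 : Tendsto (fun y : Fin n → ℂ => ‖y‖) (𝓝 0) (𝓝 0) := by
      simpa using (continuous_norm.tendsto (0 : Fin n → ℂ))
    have hγ0 : Tendsto γ (𝓝 0) (𝓝 0) := hγO.trans_tendsto hnorm0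
    have hη0 : Tendsto (fun y => integralMap g (γ y)) (𝓝 0) (𝓝 0) := by
      have := (analyticAt_integralMap g 0).continuousAt.tendsto
      rw [integralMap_zero g hg0] at this
      exact this.comp hγ0
    -- The defect of the approximate solution is the antiderivative of `Φ' - g(Φ)` plus the error in
    -- the initial value.
    have herr : (fun y => c y - integralMap g (γ y)) =O[𝓝 0] fun y => ‖y‖ ^ (ν + 1) := by
      rw [isBigO_pi]
      intro k
      have h1 := isBigO_polynomialCurve (ν + 1) _ (hΦ' k)
      have h2 : (fun y : Fin n → ℂ => algebraMap ℂ C(Set.Icc (0 : ℝ) 1, ℂ)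
          (MvPolynomial.aeval y ((Φ k).eval 0 - MvPolynomial.X k)))
          =O[𝓝 0] fun y => ‖y‖ ^ (ν + 1) := by
        refine IsBigO.trans (IsBigO.of_bound 1 (Eventually.of_forall fun y => ?_))
          (isBigO_aeval_of_mem_pow (B := ℂ) (ν + 1) _ (hΦ0 k))
        rw [one_mul, norm_algebraMap']
      have h3 := (primitive.isBigO_comp (fun y : Fin n → ℂ => polynomialCurve y
        (Polynomial.derivative (Φ k) - MvPolynomial.aeval Φ (g k))) (𝓝 0)).trans h1
      refine (h3.add h2).neg_left.congr_left fun y => ?_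
      have h4 : polynomialCurve y (MvPolynomial.aeval Φ (g k)) = MvPolynomial.aeval (γ y) (g k) :=
        MvPolynomial.comp_aeval_apply (R := ℂ) Φ (polynomialCurve y) (g k)
      rw [map_sub, h4, map_sub, primitive_polynomialCurve_derivative, map_sub, map_sub,
        MvPolynomial.aeval_X, MvPolynomial.aeval_eq_eval]
      simp only [Pi.sub_apply, hc, integralMap, hγ]
      ring
    -- The true solution is `Ψ(c y)` and the approximate one is `Ψ(integralMap g (γ y))`; the
    -- Lipschitz bound transfers the defect.
    obtain ⟨K, s, hs, hK⟩ := (hΨa.contDiffAt (n := 1)).exists_lipschitzOnWith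
    have hdiff : (fun y => Ψ (c y) - γ y) =O[𝓝 0] fun y => ‖y‖ ^ (ν + 1) := by
      refine IsBigO.trans (IsBigO.of_bound K ?_) herr
      filter_upwards [hc0.eventually hs, hη0.eventually hs, hγ0.eventually hΨl] with y h1 h2 h3
      have := hK.norm_sub_le h1 h2
      rwa [h3] at this
    refine ((e.isBigO_comp _ _).trans hdiff).congr_left fun y => ?_
    rw [map_sub]
    congr 1
    rw [he]
    funext k
    simp only [hγ]
    rw [polynomialCurve_apply]
    have h3 : (1 : ℂ) = MvPolynomial.eval y (1 : MvPolynomial (Fin n) ℂ) := by simp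
    rw [Complex.ofReal_one, h3, Polynomial.eval_map_apply]

/-! ### Jets of germs -/

theorem isBigO_eval_of_mem_pow (d : ℕ) (p : Fin n → MvPolynomial (Fin n) ℂ)
    (hp : ∀ k, p k ∈ MvPolynomial.idealOfVars (Fin n) ℂ ^ d) :
    (fun (y : Fin n → ℂ) k => MvPolynomial.eval y (p k)) =O[𝓝 0] fun y => ‖y‖ ^ d := by
  rw [isBigO_pi]
  intro k
  have := isBigO_aeval_of_mem_pow (B := ℂ) d (p k) (hp k)
  simpa only [MvPolynomial.aeval_eq_eval] using this

theorem SameJet.mono {ν ν' : ℕ} (hν : ν ≤ ν') {h : (Fin n → ℂ) → (Fin n → ℂ)} {f : FormalMap n}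
    (H : SameJet ν' h f) : SameJet ν h f := by
  have h1 : (fun y : Fin n → ℂ => ‖y‖ ^ (ν' + 1)) =O[𝓝 0] fun y => ‖y‖ ^ (ν + 1) := by
    refine IsBigO.of_bound 1 ?_
    filter_upwards [Metric.ball_mem_nhds (0 : Fin n → ℂ) one_pos] with y hy
    rw [mem_ball_zero_iff] at hy
    simpa using pow_le_pow_of_le_one (norm_nonneg y) hy.le (Nat.succ_le_succ hν)
  have h2 := isBigO_eval_of_mem_pow (ν + 1) _ (f.jet_sub_jet_mem hν)
  refine ((IsBigO.trans H h1).add h2).congr_left fun y => ?_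
  funext k
  simp [FormalMap.eval_jet]

theorem SameJet.hasFDerivAt {h : (Fin n → ℂ) → (Fin n → ℂ)} {f : FormalMap n}
    (hf : ∀ k, MvPowerSeries.constantCoeff (f k) = 0) (H : SameJet 1 h f) :
    HasFDerivAt h (f.linearPart.mulVecLin.toContinuousLinearMap) 0 := by
  have h2 := isBigO_eval_of_mem_pow 2 _ (f.jet_sub_linearPart_mem hf le_rfl)
  have h3 : (fun y => h y - f.linearPart.mulVecLin.toContinuousLinearMap y)
      =O[𝓝 0] fun y : Fin n → ℂ => ‖y - 0‖ ^ 2 := by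
    simp only [sub_zero]
    refine (IsBigO.add H h2).congr_left fun y => ?_
    funext k
    simp [FormalMap.eval_jet, Matrix.mulVec, dotProduct, MvPolynomial.smul_eval]
  have h4 : HasFDerivAt (fun y => h y - f.linearPart.mulVecLin.toContinuousLinearMap y)
      (0 : (Fin n → ℂ) →L[ℂ] (Fin n → ℂ)) 0 := h3.hasFDerivAt (by norm_num)
  have h5 := h4.add f.linearPart.mulVecLin.toContinuousLinearMap.hasFDerivAt
  rw [zero_add] at h5
  refine h5.congr_of_eventuallyEq (Eventually.of_forall fun y => ?_)
  simp

theorem isInvertible_mulVecLin {M : Matrix (Fin n) (Fin n) ℂ} (hM : IsUnit M) :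
    (M.mulVecLin.toContinuousLinearMap : (Fin n → ℂ) →L[ℂ] (Fin n → ℂ)).IsInvertible := by
  obtain ⟨u, rfl⟩ := hM
  refine ⟨ContinuousLinearEquiv.equivOfInverse (u : Matrix (Fin n) (Fin n) ℂ).mulVecLin.toContinuousLinearMap
    ((u⁻¹ : (Matrix (Fin n) (Fin n) ℂ)ˣ) : Matrix (Fin n) (Fin n) ℂ).mulVecLin.toContinuousLinearMap
    (fun y => ?_) (fun y => ?_), ?_⟩
  · simp only [LinearMap.coe_toContinuousLinearMap', Matrix.mulVecLin_apply, Matrix.mulVec_mulVec,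
      Units.inv_mul, Matrix.one_mulVec]
  · simp only [LinearMap.coe_toContinuousLinearMap', Matrix.mulVecLin_apply, Matrix.mulVec_mulVec,
      Units.mul_inv, Matrix.one_mulVec]
  · ext; rfl

/-! ### The polynomial system -/

/-- The polynomial obtained from `q` by multiplying the monomial `y^j` with `x^(w j)`. -/
def weightedLift (q : MvPolynomial (Fin n) ℂ) (w : (Fin n →₀ ℕ) → ℕ) :
    MvPolynomial (Fin (n + 1)) ℂ :=
  ∑ j ∈ q.support, MvPolynomial.monomial (Finsupp.cons (w j) j) (q.coeff j)

theorem eval_weightedLift (q : MvPolynomial (Fin n) ℂ) (w : (Fin n →₀ ℕ) → ℕ) (x : ℂ)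
    (y : Fin n → ℂ) : MvPolynomial.eval (Fin.cons x y : Fin (n + 1) → ℂ) (weightedLift q w)
      = ∑ j ∈ q.support, q.coeff j * (x ^ w j * ∏ l, y l ^ j l) := by
  rw [weightedLift, map_sum]
  refine Finset.sum_congr rfl fun j _ => ?_
  rw [MvPolynomial.eval_monomial, Finsupp.prod_fintype _ _ (by simp), Fin.prod_univ_succ]
  simp

/-- Under `x = exp(s)`, `y_l = exp(s mu_l) z_l`, the power `x^(w j)` makes up the difference between
the weight of `y^j` and `c`, so one factor `exp(s c)` comes out of all monomials. -/
theorem eval_weightedLift_exp (q : MvPolynomial (Fin n) ℂ) (w : (Fin n →₀ ℕ) → ℕ)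
    (mu : Fin n → ℂ) (c : ℂ) (hw : ∀ j ∈ q.support, c - ∑ l, (j l : ℂ) * mu l = w j)
    (s : ℂ) (z : Fin n → ℂ) :
    MvPolynomial.eval (Fin.cons (Complex.exp s) fun l => Complex.exp (s * mu l) * z l :
      Fin (n + 1) → ℂ) (weightedLift q w) = Complex.exp (s * c) * MvPolynomial.eval z q := by
  rw [eval_weightedLift, MvPolynomial.eval_eq', Finset.mul_sum]
  refine Finset.sum_congr rfl fun j hj => ?_
  have h1 : c = w j + ∑ l, (j l : ℂ) * mu l := by rw [← hw j hj]; ring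
  simp only [mul_pow, Finset.prod_mul_distrib]
  have h2 : ∏ l, Complex.exp (s * mu l) ^ j l = Complex.exp (s * ∑ l, (j l : ℂ) * mu l) := by
    rw [Finset.mul_sum, Complex.exp_sum]
    refine Finset.prod_congr rfl fun l _ => ?_
    rw [← Complex.exp_nat_mul]
    ring_nf
  rw [h2, h1, mul_add, Complex.exp_add, ← Complex.exp_nat_mul, mul_comm s (w j : ℂ)]
  ring

theorem weightedLift_mem_sq (q : MvPolynomial (Fin n) ℂ) (w : (Fin n →₀ ℕ) → ℕ)
    (hq : q ∈ MvPolynomial.idealOfVars (Fin n) ℂ ^ 2) :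
    weightedLift q w ∈ MvPolynomial.idealOfVars (Fin (n + 1)) ℂ ^ 2 := by
  refine Submodule.sum_mem _ fun j hj => ?_
  rw [MvPolynomial.monomial_mem_pow_idealOfVars_iff _ _ (MvPolynomial.mem_support_iff.1 hj)]
  have h1 := (MvPolynomial.mem_pow_idealOfVars_iff 2 q).1 hq j hj
  rw [Finsupp.degree_eq_sum] at h1 ⊢
  rw [Fin.sum_univ_succ]
  simp only [Finsupp.cons_zero, Finsupp.cons_succ]
  omega

theorem isAdmissible_polyMap {G : Fin n → MvPolynomial (Fin (n + 1)) ℂ}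
    (h0 : ∀ x, polyMap G (x, 0) = 0)
    (hG : ∀ k, G k ∈ MvPolynomial.idealOfVars (Fin (n + 1)) ℂ ^ 2) : IsAdmissible (polyMap G) := by
  refine ⟨h0, ?_⟩
  rw [hasFDerivAt_pi']
  intro k
  have hbound : ∀ p : ℂ × (Fin n → ℂ), ‖(Fin.cons p.1 p.2 : Fin (n + 1) → ℂ)‖ ≤ ‖p‖ := by
    intro p
    refine (pi_norm_le_iff_of_nonneg (norm_nonneg _)).2 fun i => ?_
    refine Fin.cases ?_ (fun l => ?_) i
    · exact norm_fst_le p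
    · exact (norm_le_pi_norm p.2 l).trans (norm_snd_le p)
  have hO : (fun p : ℂ × (Fin n → ℂ) => (Fin.cons p.1 p.2 : Fin (n + 1) → ℂ))
      =O[𝓝 0] fun p => p := IsBigO.of_bound 1 (Eventually.of_forall fun p => by
        simpa using hbound p)
  have ht : Tendsto (fun p : ℂ × (Fin n → ℂ) => (Fin.cons p.1 p.2 : Fin (n + 1) → ℂ)) (𝓝 0)
      (𝓝 0) := hO.trans_tendsto tendsto_id
  have h1 := (isBigO_aeval_of_mem_pow (B := ℂ) 2 (G k) (hG k)).comp_tendsto ht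
  have h2 := h1.trans (hO.norm_norm.pow 2)
  refine IsBigO.hasFDerivAt (n := 2) (f := fun p => polyMap G p k) ?_ (by norm_num)
  have h3 : (fun p => polyMap G p k) =O[𝓝 0] fun p : ℂ × (Fin n → ℂ) => ‖p‖ ^ 2 := h2
  simpa only [sub_zero] using h3

/-- The lift is `y_k = exp(iθ mu_k) z_k(θ/2π)`. Its derivative is `i (mu_k y_k + exp(iθ mu_k)
g_k(z)/(2πi))`, whence the constant `(2πi)⁻¹`; the part `2πi N z` of `g(z)` restores `N y`. -/
theorem isHolonomy_of_time_one_map {A N : Matrix (Fin n) (Fin n) ℂ} {mu : Fin n → ℂ}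
    (hA : IsAdditiveJordan A (Matrix.diagonal mu) N) (g : Fin n → MvPolynomial (Fin n) ℂ)
    (w : Fin n → (Fin n →₀ ℕ) → ℕ)
    (hw : ∀ k, ∀ j ∈ (g k - ∑ l, ((2 * Real.pi * Complex.I : ℂ) • N) k l • MvPolynomial.X l).support,
      mu k - ∑ l, (j l : ℂ) * mu l = w k j) (h : (Fin n → ℂ) → (Fin n → ℂ))
    (hz : ∀ᶠ y in 𝓝 0, ∃ z : ℝ → Fin n → ℂ, z 0 = y ∧ z 1 = h y ∧
        ∀ t ∈ Set.Icc (0 : ℝ) 1,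
          HasDerivWithinAt z (fun k => MvPolynomial.eval (z t) (g k)) (Set.Icc 0 1) t) :
    IsHolonomy (systemField A (polyMap fun k =>
      MvPolynomial.C ((2 * Real.pi * Complex.I : ℂ)⁻¹) * weightedLift
        (g k - ∑ l, ((2 * Real.pi * Complex.I : ℂ) • N) k l • MvPolynomial.X l) (w k))) 1
      (fun y k => Complex.exp (2 * Real.pi * Complex.I * mu k) * h y k) := by
  filter_upwards [hz] with y ⟨z, hz0, hz1, hz⟩
  have hpi : (0 : ℝ) < 2 * Real.pi := Real.two_pi_pos
  refine ⟨fun θ => (Complex.exp (θ * Complex.I),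
    fun k => Complex.exp (θ * Complex.I * mu k) * z (θ / (2 * Real.pi)) k), ?_, ?_, ?_⟩
  · intro θ hθ
    -- On `x = exp(iθ)` one has `dx/dθ = i x`, so the velocity is `i` times the field.
    refine ⟨by simp, Complex.I, ?_⟩
    have hθ' : θ / (2 * Real.pi) ∈ Set.Icc (0 : ℝ) 1 :=
      ⟨div_nonneg hθ.1 hpi.le, (div_le_one hpi).2 hθ.2⟩
    set t := θ / (2 * Real.pi) with ht
    have hlin : HasDerivAt (fun s : ℝ => (s : ℂ) * Complex.I) Complex.I θ := by
      simpa using (Complex.ofRealCLM.hasDerivAt (x := θ)).mul_const Complex.I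
    have hx : HasDerivAt (fun s : ℝ => Complex.exp (s * Complex.I))
        (Complex.exp (θ * Complex.I) * Complex.I) θ := hlin.cexp
    have hzt : HasDerivWithinAt (fun s : ℝ => z (s / (2 * Real.pi)))
        ((1 / (2 * Real.pi)) • fun k => MvPolynomial.eval (z t) (g k))
        (Set.Icc 0 (2 * Real.pi)) θ := by
      refine HasDerivWithinAt.scomp (t' := Set.Icc 0 1) θ (hz t hθ')
        ((hasDerivAt_id θ).div_const _).hasDerivWithinAt ?_
      intro s hs
      exact ⟨div_nonneg hs.1 hpi.le, (div_le_one hpi).2 hs.2⟩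
    rw [systemField, Prod.smul_mk]
    refine HasDerivWithinAt.prodMk ?_ ?_
    · rw [smul_eq_mul, mul_comm]
      exact hx.hasDerivWithinAt
    · rw [hasDerivWithinAt_pi]
      intro k
      have he : HasDerivAt (fun s : ℝ => Complex.exp (s * Complex.I * mu k))
          (Complex.exp (θ * Complex.I * mu k) * (Complex.I * mu k)) θ :=
        (hlin.mul_const (mu k)).cexp
      have hk := he.hasDerivWithinAt.mul ((hasDerivWithinAt_pi.1 hzt) k)
      refine hk.congr_deriv ?_
      set q := g k - ∑ l, ((2 * Real.pi * Complex.I : ℂ) • N) k l • MvPolynomial.X l with hq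
      have h1 : MvPolynomial.eval (z t) (g k)
          = (2 * Real.pi * Complex.I) * (∑ l, N k l * z t l) + MvPolynomial.eval (z t) q := by
        rw [hq]
        simp [MvPolynomial.smul_eval, Finset.mul_sum, mul_assoc]
      have h2 : (A.mulVec fun k => Complex.exp (θ * Complex.I * mu k) * z t k) k
          = Complex.exp (θ * Complex.I * mu k) * (mu k * z t k + ∑ l, N k l * z t l) := by
        rw [hA.add_eq, Matrix.add_mulVec, Pi.add_apply, Matrix.mulVec_diagonal, mul_add,
          Finset.mul_sum]
        congr 1
        · ring
        · simp only [Matrix.mulVec, dotProduct]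
          refine Finset.sum_congr rfl fun l _ => ?_
          -- A nonzero entry forces `mu_k = mu_l`, so the exponential factors out of the row.
          by_cases hN : N k l = 0
          · simp [hN]
          · rw [commute_diagonal_apply hA.commute hN]
            ring
      have h3 := eval_weightedLift_exp q (w k) mu (mu k) (hw k) (θ * Complex.I) (z t)
      simp only [Pi.smul_apply, Pi.add_apply, polyMap, map_mul, MvPolynomial.eval_C]
      rw [h2, h3, h1, smul_eq_mul, Complex.real_smul]
      have hpi' : (Real.pi : ℂ) ≠ 0 := by exact_mod_cast Real.pi_ne_zero
      push_cast
      field_simp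
      ring
  · simp [hz0]
  · have h1 : (2 * Real.pi : ℝ) / (2 * Real.pi) = 1 := div_self hpi.ne'
    simp only [h1, hz1]
    push_cast
    rw [Complex.exp_two_pi_mul_I]

end FormalHolonomy

end

/-! ### Assembly of the system and its holonomy -/

theorem proposition5p1 {n : ℕ} (f : FormalHolonomy.FormalMap n)
    (A : Matrix (Fin n) (Fin n) ℂ) (mu : Fin n → ℂ)
    (hf : FormalHolonomy.IsFormalDiffeo f)
    (hnormal : FormalHolonomy.IsInNormalForm f A mu)
    (hA : FormalHolonomy.HasNegativeSpectrum A)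
    (hres : FormalHolonomy.HasNoNegativeResonances f mu) (ν : ℕ) :
    ∃ G : Fin n → MvPolynomial (Fin (n + 1)) ℂ,
      FormalHolonomy.IsAdmissible (FormalHolonomy.polyMap G) ∧
      ∃ h : (Fin n → ℂ) → (Fin n → ℂ),
        FormalHolonomy.IsLocalBiholomorphism h ∧
        FormalHolonomy.IsHolonomy
          (FormalHolonomy.systemField A (FormalHolonomy.polyMap G)) 1 h ∧
        FormalHolonomy.SameJet ν h f := by
  open FormalHolonomy in
  obtain ⟨N, hN⟩ := hnormal.jordan
  obtain ⟨u, hu⟩ := hnormal.jordanChevalley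
  have hN' : IsNilpotent ((2 * Real.pi * Complex.I : ℂ) • N) := by
    obtain ⟨r, hr⟩ := hN.nilpotent
    exact ⟨r, by rw [smul_pow, hr, smul_zero]⟩
  have hu0 := hu.diffeo_u.constantCoeff_eq_zero
  -- The order is `ν + 1` rather than `ν`, so that the jet contains the linear part even for `ν =
  -- 0`; invertibility of the holonomy is read off from it.
  obtain ⟨g, Φ, hgV, hgN, hΦ, hΦ', hΦ0, hΦ1⟩ := exists_infinitesimal_generator mu _ hN'
    (u.jet (ν + 1)) (u.jet_mem_idealOfVars hu0 (ν + 1))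
    (jet_mem_resonantSubmodule hnormal.linearPart_eq hN hu hres (ν + 1))
    (fun k => by
      rw [← linearPart_eq_exp_nilpotent hnormal.linearPart_eq hN hu]
      exact u.jet_sub_linearPart_mem hu0 (by omega) k) (ν + 1) (by omega)
  obtain ⟨h, h0, ha, hz, hO⟩ := exists_time_one_map g _ hN' hgN Φ (ν + 1) hΦ hΦ' hΦ0
  have hqV : ∀ k, g k - ∑ l, ((2 * Real.pi * Complex.I : ℂ) • N) k l • MvPolynomial.X l
      ∈ resonantSubmodule mu (mu k) := by
    intro k
    refine Submodule.sub_mem _ (hgV k) (Submodule.sum_mem _ fun l _ => ?_)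
    by_cases hkl : N k l = 0
    · simp [hkl]
    · rw [commute_diagonal_apply hN.commute hkl]
      exact Submodule.smul_mem _ _ (X_mem_resonantSubmodule mu l)
  -- The exponents of `x` are the resonance numbers of the nonlinear monomials of `g`.
  choose! w hw using fun k => mem_resonantSubmodule.1 (hqV k)
  have hjet : SameJet (ν + 1)
      (fun y k => Complex.exp (2 * Real.pi * Complex.I * mu k) * h y k) f := by
    have h1 := Asymptotics.IsBigO.add hO (isBigO_eval_of_mem_pow _ _ hΦ1)
    rw [SameJet, Asymptotics.isBigO_pi]
    intro k
    have h2 := (Asymptotics.isBigO_pi.1 h1 k).const_mul_left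
      (Complex.exp (2 * Real.pi * Complex.I * mu k))
    refine h2.congr_left fun y => ?_
    have h3 : f.jet (ν + 1) k
        = MvPolynomial.C (Complex.exp (2 * Real.pi * Complex.I * mu k)) * u.jet (ν + 1) k := by
      ext j
      rw [MvPolynomial.coeff_C_mul, FormalMap.coeff_jet, FormalMap.coeff_jet,
        coef_eq_mul_of_isJordanChevalley hu, mul_ite, mul_zero]
    simp only [Pi.sub_apply, Pi.add_apply, ← FormalMap.eval_jet, h3, map_mul, map_sub,
      MvPolynomial.eval_C]
    ring
  refine ⟨_, isAdmissible_polyMap (fun x => ?_) (fun k => ?_), _, ⟨?_, ?_, ?_⟩,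
    isHolonomy_of_time_one_map hN g w hw h hz, hjet.mono (by omega)⟩
  · funext k
    simp only [polyMap, map_mul, eval_weightedLift]
    rw [Finset.sum_eq_zero, mul_zero]
    · rfl
    intro j hj
    have hd := (MvPolynomial.mem_pow_idealOfVars_iff 2 _).1 (hgN k) j hj
    -- Degree at least two in `y` gives every monomial a factor `y_l`, which vanishes at `y = 0`.
    obtain ⟨l, hl⟩ : ∃ l, j l ≠ 0 := by
      by_contra! hcon
      rw [Finsupp.degree_eq_sum, Finset.sum_eq_zero fun l _ => hcon l] at hd
      omega
    rw [Finset.prod_eq_zero (Finset.mem_univ l), mul_zero, mul_zero]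
    simp [hl]
  · exact Ideal.mul_mem_left _ _ (weightedLift_mem_sq _ _ (hgN k))
  · funext k
    simp [h0]
  · refine AnalyticAt.pi fun k => ?_
    exact analyticAt_const.mul ((ContinuousLinearMap.proj (R := ℂ)
      (φ := fun _ : Fin n => ℂ) k).analyticAt _ |>.comp ha)
  · have hd := (hjet.mono (show 1 ≤ ν + 1 by omega)).hasFDerivAt hf.constantCoeff_eq_zero
    rw [hd.fderiv]
    exact isInvertible_mulVecLin hf.isUnit_linearPart
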